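/- **Theorem.** Consider a single electron in $\mathbb R^3$ described by a scalar (spatial) wave function, with Hamiltonian $H[v,\mathbf A]=\tfrac12(-\mathrm i\nabla+\mathbf A)^2+v$. For $i=1,2$ let $\mathbf A_i\in L^2_{\mathrm{loc}}(\mathbb R^3;\mathbb R^3)$ be a vector potential whose magnetic field $\mathbf B_i=\nabla\times\mathbf A_i$ (distributional curl) is a locally integrable function, and let $\psi_i\in L^2(\mathbb R^3;\mathbb C)$, $\|\psi_i\|=1$, have a locally integrable weak gradient and finite kinetic energy, $(-\mathrm i\nabla+\mathbf A_i)\psi_i\in L^2$. Write $\rho_{\psi}=|\psi|^2$, $\mathbf j^{\mathrm p}_\psi=\operatorname{Im}(\psi^*\nabla\psi)$. Suppose that both systems have the same particle density and the same total current density, $$\rho_{\psi_1}=\rho_{\psi_2}=\rho,\qquad \mathbf j^{\mathrm p}_{\psi_1}+\rho_{\psi_1}\mathbf A_1=\mathbf j^{\mathrm p}_{\psi_2}+\rho_{\psi_2}\mathbf A_2=\mathbf j\qquad\text{a.e.},$$ and that $\rho\neq0$ a.e. Then: 1. The magnetic field is the vorticity of $\mathbf j/\rho$: if $U\subseteq\mathbb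 R^3$ is open and on every compact subset of $U$ the density $\rho$ is bounded below a.e. by a positive constant, then $\mathbf j/\rho$ is locally integrable on $U$ and $\nabla\times(\mathbf j/\rho)=\mathbf B_1$ in the sense of distributions on $U$. 2. $\mathbf B_1=\mathbf B_2$ a.e. on $\mathbb R^3$, and there is a locally integrable $\chi:\mathbb R^3\to\mathbb R$ with $\mathbf A_2=\mathbf A_1+\nabla\chi$ (weak gradient). 3. If, moreover, $v_1,v_2:\mathbb R^3\to\mathbb R$ and $E_1,E_2\in\mathbb R$ are such that $v_i\psi_i$ is locally integrable and $\psi_i$ is an eigenstate (for instance a ground state), $H[v_i,\mathbf A_i]\psi_i=E_i\psi_i$ for $i=1,2$ in the weak sense $$\tfrac12\langle(-\mathrm i\nabla+\mathbf A_i)\varphi,(-\mathrm i\nabla+\mathbf A_i)\psi_i\rangle+\langle\varphi,v_i\psi_i\rangle=E_i\langle\varphi,\psi_i\rangle\quad\text{for all }\varphi\in C_c^\infty(\mathbb R^3;\mathbb C),$$ then $(v_1,\mathbf A_1)$ and $(v_2,\mathbf A_2)$ are equal up to a gauge transformation: $\mathbf A_2=\mathbf A_1+\nabla\chi$ for some locally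 integrable $\chi$, and $v_2=v_1+\text{constant}$ a.e. -/

import Mathlib

open MeasureTheory Set Filter
open scoped ContDiff ComplexConjugate

noncomputable section

namespace OneElectron

/-- Physical space `ℝ³` with the Euclidean norm and Lebesgue measure. -/
abbrev Space : Type := EuclideanSpace ℝ (Fin 3)

/-- The classical partial derivative `∂ₖ φ`. -/
def pderiv {F : Type*} [NormedAddCommGroup F] [NormedSpace ℝ F]
    (k : Fin 3) (φ : Space → F) (x : Space) : F :=
  fderiv ℝ φ x (EuclideanSpace.single k 1)

/-- `φ ∈ C_c^∞(U)`. -/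
structure IsTestFunction {F : Type*} [NormedAddCommGroup F] [NormedSpace ℝ F]
    (U : Set Space) (φ : Space → F) : Prop where
  smooth : ContDiff ℝ ∞ φ
  compact : HasCompactSupport φ
  subset : tsupport φ ⊆ U

/-- `G = ∇f` on `ℝ³` in the sense of distributions, for locally integrable `f` and `G`. -/
structure IsWeakGradient {F : Type*} [NormedAddCommGroup F] [NormedSpace ℝ F]
    (f : Space → F) (G : Space → Fin 3 → F) : Prop where
  locallyIntegrable : LocallyIntegrable f
  locallyIntegrable_grad : ∀ k, LocallyIntegrable (fun x => G x k)
  integral_eq : ∀ φ : Space → ℝ, IsTestFunction univ φ → ∀ k,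
    ∫ x, φ x • G x k = -∫ x, pderiv k φ x • f x

/-- `B = ∇ × F` on the open set `U` in the sense of distributions, for `F` and `B` locally
integrable on `U`.  Indices are taken modulo `3`, so that
`(∇ × F)ₖ = ∂ₖ₊₁ Fₖ₊₂ - ∂ₖ₊₂ Fₖ₊₁`. -/
structure IsWeakCurlOn (U : Set Space) (F B : Space → Space) : Prop where
  locallyIntegrableOn : LocallyIntegrableOn F U
  locallyIntegrableOn_curl : LocallyIntegrableOn B U
  integral_eq : ∀ φ : Space → ℝ, IsTestFunction U φ → ∀ k : Fin 3,
    ∫ x, φ x * B x k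
      = -∫ x, (pderiv (k + 1) φ x * F x (k + 2) - pderiv (k + 2) φ x * F x (k + 1))

/-- `A` is a locally square-integrable vector potential of the (locally integrable) magnetic
field `B = ∇ × A`. -/
structure IsVectorPotential (A B : Space → Space) : Prop where
  memLp_two_loc : ∀ K : Set Space, IsCompact K → MemLp A 2 (volume.restrict K)
  curl : IsWeakCurlOn univ A B

/-- A normalized one-electron wave function `ψ ∈ L²(ℝ³; ℂ)` with finite kinetic energy
`½ ∫ |(-i∇ + A)ψ|²` in the vector potential `A`, where `∇ψ` is the weak gradient. -/
structure State (A : Space → Space) where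
  ψ : Space → ℂ
  grad : Space → Fin 3 → ℂ
  isWeakGradient : IsWeakGradient ψ grad
  memLp : MemLp ψ 2
  normalized : ∫ x, ‖ψ x‖ ^ 2 = 1
  kinetic : ∀ k, MemLp (fun x => -Complex.I * grad x k + (A x k : ℂ) * ψ x) 2

namespace State

variable {A : Space → Space} (s : State A)

/-- The particle density `ρ_ψ = |ψ|²`. -/
def density (x : Space) : ℝ := ‖s.ψ x‖ ^ 2

/-- The paramagnetic current density `j^p_ψ = Im (ψ* ∇ψ)`. -/
def paramagneticCurrent (x : Space) : Space :=
  WithLp.toLp 2 fun k => (conj (s.ψ x) * s.grad x k).im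

/-- The total (physical) current density `j = j^p_ψ + ρ_ψ A`. -/
def totalCurrent (x : Space) : Space :=
  s.paramagneticCurrent x + s.density x • A x

/-- `H[v, A] ψ = E ψ` weakly, where `H[v, A] = ½ (-i∇ + A)² + v`: for all
`φ ∈ C_c^∞(ℝ³; ℂ)`,
`½ ⟨(-i∇ + A)φ, (-i∇ + A)ψ⟩ + ⟨φ, v ψ⟩ = E ⟨φ, ψ⟩`. -/
structure IsEigenstate (v : Space → ℝ) (E : ℝ) : Prop where
  locallyIntegrable : LocallyIntegrable (fun x => (v x : ℂ) * s.ψ x)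
  integral_eq : ∀ φ : Space → ℂ, IsTestFunction univ φ →
    (1 / 2 : ℂ) * (∫ x, ∑ k : Fin 3,
        conj (-Complex.I * pderiv k φ x + (A x k : ℂ) * φ x)
          * (-Complex.I * s.grad x k + (A x k : ℂ) * s.ψ x))
      + ∫ x, conj (φ x) * ((v x : ℂ) * s.ψ x)
      = (E : ℂ) * ∫ x, conj (φ x) * s.ψ x

end State

/-- `A₂ = A₁ + ∇χ` for some locally integrable gauge function `χ : ℝ³ → ℝ`. -/
def GaugeEquivalentVector (A₁ A₂ : Space → Space) : Prop :=
  ∃ χ : Space → ℝ, IsWeakGradient χ (fun x k => A₂ x k - A₁ x k)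

/-- `(v₂, A₂)` arises from `(v₁, A₁)` by a (time-independent) gauge transformation:
`A₂ = A₁ + ∇χ` and `v₂ = v₁ + constant`. -/
def GaugeEquivalent (v₁ : Space → ℝ) (A₁ : Space → Space)
    (v₂ : Space → ℝ) (A₂ : Space → Space) : Prop :=
  GaugeEquivalentVector A₁ A₂ ∧ ∃ c : ℝ, ∀ᵐ x, v₂ x = v₁ x + c

end OneElectron

end

open scoped Topology ENNReal
open ContinuousLinearMap (lsmul)

noncomputable section

namespace OneElectron

variable {F : Type*} [NormedAddCommGroup F] [NormedSpace ℝ F]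

/-! ### Mollification -/

/-! Write `π = (-i∇ + A)ψ` and `σ = Re(ψ* ∇ψ)`, which is half the gradient of `ρ`. Formally `j/ρ = A
+ ∇ arg ψ`, and taking the curl gives `B`. But `arg ψ` need not make global sense, `ρ` may be
arbitrarily small, and `∇ψ` is only known to be locally integrable. The phase is therefore replaced
by `u = ψ/(δ + ρ)^{1/2} = p + iq`. It is bounded by `1`, and its weak gradient is locally
square-integrable: `π` lies in `L²`, and the remaining part `Aψ` of `∇ψ` is damped to the size of
`A` by the derivative of the phase.

With `m = |u|² = ρ/(δ + ρ)` one has `m A + p∇q - q∇p = j/(δ + ρ)`. Each product on the left is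
regular enough for the weak product rule, which yields `m B = ∇ × (j/(δ + ρ)) - 2δ/(δ + ρ)² (σ ×
j)/ρ` (`State.integral_curl_regularized`). The right side involves only `ρ`, `j` and `σ`, and `σ` is
determined by `ρ` (`State.halfGradDensity_ae_eq`). Taking `δ = 1` and dividing by `m ≠ 0` gives `B₁
= B₂` (`State.curl_ae_eq`). Letting `δ → 0` where `ρ` is locally bounded below removes the error
term and gives the vorticity formula (`State.isWeakCurlOn_velocity`).

The difference `A₂ - A₁` is then curl-free, hence a gradient by a Poincaré lemma for locally
integrable fields (`exists_isWeakGradient_of_curl_eq_zero`).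

For the scalar potential, the eigenvalue equation is tested with `η u`, `δ = 1`, and the real part
is taken. The potential enters as `ρ (v - E)/(1 + ρ)^{1/2}`. The kinetic term depends only on `ρ`,
`j`, `σ`, because `ρ |π|² = |j|² + |σ|²` (`State.sq_add_sq_eq`). So `v₁ - E₁ = v₂ - E₂`
(`State.IsEigenstate.exists_const`). -/

/-- A smooth bump of radius `1 / (n + 1)` around the origin. -/
def bump (n : ℕ) : ContDiffBump (0 : Space) :=
  ⟨1 / (2 * (n + 1)), 1 / (n + 1), by positivity, by
    apply one_div_lt_one_div_of_lt <;> linarith [(n.cast_nonneg : (0 : ℝ) ≤ n)]⟩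

/-- The standard mollifier with support in the ball of radius `1 / (n + 1)`. -/
def kernel (n : ℕ) : Space → ℝ := (bump n).normed volume

/-- The mollification of `f` at scale `1 / (n + 1)`. -/
def mollify (n : ℕ) (f : Space → F) : Space → F :=
  MeasureTheory.convolution (kernel n) f (lsmul ℝ ℝ) volume

/-- Local `L^p` integrability. -/
def LocMemLp {E : Type*} [NormedAddCommGroup E] (p : ℝ≥0∞) (f : Space → E) : Prop :=
  ∀ K : Set Space, IsCompact K → MemLp f p (volume.restrict K)

lemma kernel_contDiff (n : ℕ) : ContDiff ℝ ∞ (kernel n) := (bump n).contDiff_normed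

lemma kernel_continuous (n : ℕ) : Continuous (kernel n) := (bump n).continuous_normed

lemma kernel_nonneg (n : ℕ) (x : Space) : 0 ≤ kernel n x := (bump n).nonneg_normed x

lemma kernel_hasCompactSupport (n : ℕ) : HasCompactSupport (kernel n) :=
  (bump n).hasCompactSupport_normed

lemma kernel_integrable (n : ℕ) : Integrable (kernel n) := (bump n).integrable_normed

lemma integral_kernel (n : ℕ) : ∫ x, kernel n x = 1 := (bump n).integral_normed

lemma kernel_eq_zero {n : ℕ} {x : Space} (hx : 1 / ((n : ℝ) + 1) ≤ ‖x‖) : kernel n x = 0 := by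
  have : x ∉ Function.support (kernel n) := by
    rw [kernel, ContDiffBump.support_normed_eq, Metric.mem_ball, dist_zero_right, not_lt]
    exact hx
  simpa using this

lemma kernel_eq_zero_of_one_le {n : ℕ} {x : Space} (hx : 1 ≤ ‖x‖) : kernel n x = 0 := by
  refine kernel_eq_zero (le_trans ?_ hx)
  rw [div_le_one (by positivity)]
  linarith [(n.cast_nonneg : (0 : ℝ) ≤ n)]

lemma mollify_apply (n : ℕ) (f : Space → F) (x : Space) :
    mollify n f x = ∫ t, kernel n t • f (x - t) := rfl

lemma mollify_apply_swap (n : ℕ) (f : Space → F) (x : Space) :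
    mollify n f x = ∫ t, kernel n (x - t) • f t := by
  rw [mollify, MeasureTheory.convolution_eq_swap]; rfl

lemma mollify_contDiff (n : ℕ) {f : Space → F} (hf : LocallyIntegrable f) :
    ContDiff ℝ ∞ (mollify n f) :=
  (kernel_hasCompactSupport n).contDiff_convolution_left (n := ⊤) _ (kernel_contDiff n) hf

lemma mollify_integrable (n : ℕ) {f : Space → F} (hf : LocallyIntegrable f) (x : Space) :
    Integrable fun t => kernel n t • f (x - t) :=
  (kernel_hasCompactSupport n).convolutionExists_left (lsmul ℝ ℝ) (kernel_continuous n) hf x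

lemma norm_mollify_le (n : ℕ) {f : Space → F} {M : ℝ} (hf : ∀ x, ‖f x‖ ≤ M) (x : Space) :
    ‖mollify n f x‖ ≤ M := by
  rw [mollify_apply]
  calc _ ≤ ∫ t, kernel n t * M := by
        refine norm_integral_le_of_norm_le ((kernel_integrable n).mul_const _) (ae_of_all _ ?_)
        intro t
        rw [norm_smul, Real.norm_of_nonneg (kernel_nonneg n t)]
        exact mul_le_mul_of_nonneg_left (hf _) (kernel_nonneg n t)
    _ = M := by rw [integral_mul_const, integral_kernel, one_mul]

lemma mollify_congr_on_closedBall (n : ℕ) {f g : Space → F} {R : ℝ}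
    (h : ∀ x, ‖x‖ ≤ R + 1 → f x = g x) {x : Space} (hx : ‖x‖ ≤ R) :
    mollify n f x = mollify n g x := by
  rw [mollify_apply, mollify_apply]
  refine integral_congr_ae (ae_of_all _ fun t => ?_)
  by_cases ht : 1 ≤ ‖t‖
  · simp [kernel_eq_zero_of_one_le ht]
  · have : ‖x - t‖ ≤ R + 1 := (norm_sub_le _ _).trans (by linarith)
    simp [h _ this]

lemma mollify_eq_zero (n : ℕ) {f : Space → F} {R : ℝ} (h : ∀ x, R < ‖x‖ → f x = 0) {x : Space}
    (hx : R + 1 < ‖x‖) : mollify n f x = 0 := by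
  rw [mollify_apply]
  refine integral_eq_zero_of_ae (ae_of_all _ fun t => ?_)
  by_cases ht : 1 ≤ ‖t‖
  · simp [kernel_eq_zero_of_one_le ht]
  · have : R < ‖x - t‖ := by linarith [norm_sub_norm_le x t]
    simp [h _ this]

lemma ae_tendsto_mollify [CompleteSpace F] {f : Space → F} (hf : LocallyIntegrable f) :
    ∀ᵐ x, Tendsto (fun n => mollify n f x) atTop (𝓝 (f x)) := by
  -- `K = 2` is the ratio of the outer to the inner radius of `bump n`; Lebesgue differentiation
  -- needs it bounded.
  refine ContDiffBump.ae_convolution_tendsto_right_of_locallyIntegrable (K := 2) (φ := bump)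
    ?_ (Eventually.of_forall fun n => ?_) hf
  · exact tendsto_one_div_add_atTop_nhds_zero_nat
  · change 1 / ((n : ℝ) + 1) ≤ 2 * (1 / (2 * (n + 1)))
    apply le_of_eq; field_simp

lemma pderiv_comp_sub (k : Fin 3) {φ : Space → ℝ} (hφ : ContDiff ℝ ∞ φ) (x t : Space) :
    pderiv k (fun t => φ (x - t)) t = -pderiv k φ (x - t) := by
  have h : HasFDerivAt (fun t => φ (x - t)) ((fderiv ℝ φ (x - t)).comp
      (-ContinuousLinearMap.id ℝ Space)) t :=
    ((hφ.differentiable (by simp)) (x - t)).hasFDerivAt.comp t ((hasFDerivAt_id t).const_sub x)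
  simp [pderiv, h.fderiv]

lemma isTestFunction_kernel_sub (n : ℕ) (x : Space) :
    IsTestFunction univ fun t => kernel n (x - t) where
  smooth := (kernel_contDiff n).comp (contDiff_const.sub contDiff_id)
  compact := (kernel_hasCompactSupport n).comp_homeomorph (Homeomorph.subLeft x)
  subset := subset_univ _

lemma pderiv_mollify (n : ℕ) {f : Space → F} (hf : LocallyIntegrable f) (k : Fin 3) (x : Space) :
    pderiv k (mollify n f) x = -∫ t, pderiv k (fun t => kernel n (x - t)) t • f t := by
  have h := (kernel_hasCompactSupport n).hasFDerivAt_convolution_left (lsmul ℝ ℝ)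
    ((kernel_contDiff n).of_le (by simp)) hf x
  have hex : Integrable (fun t => ContinuousLinearMap.precompL Space (lsmul ℝ ℝ (E := F))
      (fderiv ℝ (kernel n) t) (f (x - t))) :=
    ((kernel_hasCompactSupport n).fderiv ℝ).convolutionExists_left _
      ((kernel_contDiff n).continuous_fderiv (by simp)) hf x
  have h2 : pderiv k (mollify n f) x = ∫ t, pderiv k (kernel n) t • f (x - t) := by
    rw [pderiv, mollify, h.fderiv, MeasureTheory.convolution_def,
      ContinuousLinearMap.integral_apply hex]
    rfl
  rw [h2, ← integral_neg, ← integral_sub_left_eq_self _ _ x]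
  refine integral_congr_ae (ae_of_all _ fun t => ?_)
  simp only [pderiv_comp_sub k (kernel_contDiff n), sub_sub_cancel, neg_smul, neg_neg]

/-- The translated kernel is itself a test function, so the definition of the weak gradient applies
to it directly. -/
lemma IsWeakGradient.pderiv_mollify (n : ℕ) {f : Space → F} {G : Space → Fin 3 → F}
    (h : IsWeakGradient f G) (k : Fin 3) (x : Space) :
    pderiv k (mollify n f) x = mollify n (fun y => G y k) x := by
  rw [OneElectron.pderiv_mollify n h.locallyIntegrable, mollify_apply_swap,
    h.integral_eq _ (isTestFunction_kernel_sub n x) k]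

lemma tendsto_eLpNorm_translate_sub {E : Type*} [NormedAddCommGroup E] {p : ℝ≥0∞}
    [Fact (1 ≤ p)] (hp : p ≠ ⊤) {f : Space → E}
    (hf : MemLp f p) :
    Tendsto (fun t : Space => eLpNorm (fun x => f (x - t) - f x) p) (𝓝 0) (𝓝 0) := by
  let g : C(Space, C(Space, Space)) :=
    ContinuousMap.curry ⟨fun z : Space × Space => z.2 - z.1, by fun_prop⟩
  have hg (t : Space) : MeasurePreserving (g t) volume volume :=
    measurePreserving_sub_right volume t
  have h := (tendsto_const_nhds (x := hf.toLp) (f := 𝓝 (0 : Space))).compMeasurePreservingLp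
    (g.continuous.tendsto 0) hg (hg 0) hp
  rw [Lp.tendsto_Lp_iff_tendsto_eLpNorm'] at h
  refine h.congr fun t => eLpNorm_congr_ae ?_
  have h1 : ∀ t, Lp.compMeasurePreserving (g t) (hg t) hf.toLp =ᵐ[volume] f ∘ g t := fun t =>
    (Lp.coeFn_compMeasurePreserving _ (hg t)).trans
      ((hg t).quasiMeasurePreserving.ae_eq_comp hf.coeFn_toLp)
  filter_upwards [h1 t, h1 0] with x hx h0
  rw [Pi.sub_apply, hx, h0]
  simp [g]

/-- Jensen's inequality for the probability measure `kernel n t dt`, in the form that `L^1` norms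
are at most `L^p` norms. -/
lemma mollify_sub_self_enorm_rpow_le {p : ℝ≥0∞} [Fact (1 ≤ p)] (hp : p ≠ ⊤) (n : ℕ)
    [CompleteSpace F] {f : Space → F} (hf : LocallyIntegrable f) (x : Space) :
    ‖mollify n f x - f x‖ₑ ^ p.toReal ≤
      ∫⁻ t, ENNReal.ofReal (kernel n t) * ‖f (x - t) - f x‖ₑ ^ p.toReal := by
  have hp0 : p ≠ 0 := (one_pos.trans_le (Fact.out : 1 ≤ p)).ne'
  have hk : Measurable fun t => ENNReal.ofReal (kernel n t) :=
    (kernel_continuous n).measurable.ennreal_ofReal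
  let μ : Measure Space := volume.withDensity fun t => ENNReal.ofReal (kernel n t)
  have : IsProbabilityMeasure μ := ⟨by
    rw [withDensity_apply _ MeasurableSet.univ, setLIntegral_univ,
      ← ofReal_integral_eq_lintegral_ofReal (kernel_integrable n)
        (ae_of_all _ (kernel_nonneg n)), integral_kernel, ENNReal.ofReal_one]⟩
  have hm : AEStronglyMeasurable (fun t => f (x - t) - f x) μ := by
    refine AEStronglyMeasurable.mono_ac (withDensity_absolutelyContinuous _ _) ?_
    exact (hf.aestronglyMeasurable.comp_quasiMeasurePreserving
      (quasiMeasurePreserving_sub_left volume x)).sub aestronglyMeasurable_const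
  have e1 : mollify n f x - f x = ∫ t, kernel n t • (f (x - t) - f x) := by
    simp only [smul_sub]
    rw [integral_sub (mollify_integrable n hf x) ((kernel_integrable n).smul_const _),
      integral_smul_const, integral_kernel, one_smul, mollify_apply]
  have e2 : ‖mollify n f x - f x‖ₑ ≤ eLpNorm (fun t => f (x - t) - f x) 1 μ := by
    rw [e1, eLpNorm_one_eq_lintegral_enorm, lintegral_withDensity_eq_lintegral_mul₀' hk.aemeasurable
      hm.enorm]
    refine (enorm_integral_le_lintegral_enorm _).trans_eq (lintegral_congr fun t => ?_)
    rw [enorm_smul, Real.enorm_of_nonneg (kernel_nonneg n t)]; rfl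
  have e3 := e2.trans (eLpNorm_le_eLpNorm_of_exponent_le (Fact.out : 1 ≤ p) hm)
  rw [eLpNorm_eq_lintegral_rpow_enorm_toReal hp0 hp] at e3
  refine (ENNReal.rpow_le_rpow e3 ENNReal.toReal_nonneg).trans_eq ?_
  rw [← ENNReal.rpow_mul, one_div_mul_cancel (ENNReal.toReal_pos hp0 hp).ne', ENNReal.rpow_one,
    lintegral_withDensity_eq_lintegral_mul₀' hk.aemeasurable (hm.enorm.pow_const _)]
  rfl

/-- After Jensen and Tonelli, the error is an average of `‖f(· - t) - f‖` to the power `p` over `|t|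
< 1/(n + 1)`, which is small by continuity of translations in `L^p`. -/
lemma tendsto_eLpNorm_mollify_sub {p : ℝ≥0∞} [Fact (1 ≤ p)] (hp : p ≠ ⊤) [CompleteSpace F]
    {f : Space → F} (hf : MemLp f p) :
    Tendsto (fun n => eLpNorm (fun x => mollify n f x - f x) p) atTop (𝓝 0) := by
  have hp0 : p ≠ 0 := (one_pos.trans_le (Fact.out : 1 ≤ p)).ne'
  have hpp := ENNReal.toReal_pos hp0 hp
  have hl : LocallyIntegrable f := hf.locallyIntegrable Fact.out
  rw [ENNReal.tendsto_nhds_zero]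
  intro ε hε
  rcases eq_or_ne ε ⊤ with rfl | hεt
  · simp
  have h0 := ENNReal.tendsto_nhds_zero.1 (tendsto_eLpNorm_translate_sub hp hf) ε hε
  obtain ⟨δ, hδ, hball⟩ := Metric.eventually_nhds_iff.1 h0
  filter_upwards [(tendsto_order.1 tendsto_one_div_add_atTop_nhds_zero_nat).2 δ hδ] with n hn
  have hmeas : AEStronglyMeasurable (fun z : Space × Space => f (z.1 - z.2) - f z.1)
      (volume.prod volume) :=
    (hf.1.comp_quasiMeasurePreserving (quasiMeasurePreserving_sub volume volume)).sub
      hf.1.comp_fst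
  rw [eLpNorm_eq_lintegral_rpow_enorm_toReal hp0 hp]
  refine (ENNReal.rpow_le_rpow (z := 1 / p.toReal) (y := ε ^ p.toReal) ?_ (by positivity)).trans_eq
    (by rw [← ENNReal.rpow_mul, mul_one_div_cancel hpp.ne', ENNReal.rpow_one])
  calc ∫⁻ x, ‖mollify n f x - f x‖ₑ ^ p.toReal
      ≤ ∫⁻ x, ∫⁻ t, ENNReal.ofReal (kernel n t) * ‖f (x - t) - f x‖ₑ ^ p.toReal :=
        lintegral_mono fun x => mollify_sub_self_enorm_rpow_le hp n hl x
    _ = ∫⁻ t, ∫⁻ x, ENNReal.ofReal (kernel n t) * ‖f (x - t) - f x‖ₑ ^ p.toReal := by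
        refine lintegral_lintegral_swap ?_
        exact ((kernel_continuous n).measurable.ennreal_ofReal.comp measurable_snd).aemeasurable.mul
          (hmeas.enorm.pow_const _)
    _ ≤ ∫⁻ t, ENNReal.ofReal (kernel n t) * ε ^ p.toReal := by
        refine lintegral_mono fun t => ?_
        by_cases ht : 1 / ((n : ℝ) + 1) ≤ ‖t‖
        · simp [kernel_eq_zero ht]
        · rw [lintegral_const_mul' _ _ ENNReal.ofReal_ne_top]
          gcongr
          have := hball (y := t) (by rw [dist_zero_right]; linarith)
          rw [eLpNorm_eq_lintegral_rpow_enorm_toReal hp0 hp] at this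
          have h2 := ENNReal.rpow_le_rpow this hpp.le
          rwa [← ENNReal.rpow_mul, one_div_mul_cancel hpp.ne', ENNReal.rpow_one] at h2
    _ = ε ^ p.toReal := by
        rw [lintegral_mul_const' _ _ (ENNReal.rpow_ne_top_of_nonneg hpp.le hεt),
          ← ofReal_integral_eq_lintegral_ofReal (kernel_integrable n)
          (ae_of_all _ (kernel_nonneg n)), integral_kernel, ENNReal.ofReal_one, one_mul]

lemma exists_norm_le_of_isCompact {K : Set Space} (hK : IsCompact K) :
    ∃ R : ℝ, 0 < R ∧ ∀ x ∈ K, ‖x‖ ≤ R := by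
  obtain ⟨R, hR, h⟩ := hK.isBounded.exists_pos_norm_le
  exact ⟨R, hR, h⟩

lemma LocMemLp.tendsto_mollify {p : ℝ≥0∞} [Fact (1 ≤ p)] (hp : p ≠ ⊤) [CompleteSpace F]
    {f : Space → F} (hf : LocMemLp p f) {K : Set Space} (hK : IsCompact K) :
    Tendsto (fun n => eLpNorm (fun x => mollify n f x - f x) p (volume.restrict K)) atTop
      (𝓝 0) := by
  obtain ⟨R, hR, hKR⟩ := exists_norm_le_of_isCompact hK
  -- All kernels live in the unit ball, so on the ball of radius `R` mollification sees only values
  -- within radius `R + 1`.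
  let g : Space → F := (Metric.closedBall (0 : Space) (R + 1)).indicator f
  have hg : MemLp g p :=
    (memLp_indicator_iff_restrict measurableSet_closedBall).2 (hf _ (isCompact_closedBall _ _))
  refine tendsto_of_tendsto_of_tendsto_of_le_of_le tendsto_const_nhds
    (tendsto_eLpNorm_mollify_sub hp hg) (fun _ => zero_le) fun n => ?_
  have hfg : ∀ x, ‖x‖ ≤ R + 1 → f x = g x := fun x hx =>
    (indicator_of_mem (by simpa using hx) f).symm
  calc _ = eLpNorm (fun x => mollify n g x - g x) p (volume.restrict K) := by
        refine eLpNorm_congr_ae ?_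
        filter_upwards [ae_restrict_mem hK.measurableSet] with x hx
        rw [mollify_congr_on_closedBall n hfg (hKR x hx), hfg x ((hKR x hx).trans (by linarith))]
    _ ≤ _ := eLpNorm_mono_measure _ Measure.restrict_le_self

/-! ### Local integrability -/

lemma LocMemLp.locallyIntegrable {E : Type*} [NormedAddCommGroup E] {f : Space → E}
    (hf : LocMemLp 2 f) : LocallyIntegrable f := by
  refine locallyIntegrable_iff.2 fun K hK => ?_
  have : IsFiniteMeasure (volume.restrict K) := ⟨by simpa using hK.measure_lt_top⟩
  exact ((hf K hK).mono_exponent (by norm_num)).integrable le_rfl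

lemma locMemLp_one_of_locallyIntegrable {E : Type*} [NormedAddCommGroup E] {f : Space → E}
    (hf : LocallyIntegrable f) : LocMemLp 1 f := fun K hK =>
  memLp_one_iff_integrable.2 (locallyIntegrable_iff.1 hf K hK)

lemma LocMemLp.add {E : Type*} [NormedAddCommGroup E] {p : ℝ≥0∞} {f g : Space → E}
    (hf : LocMemLp p f) (hg : LocMemLp p g) : LocMemLp p (fun x => f x + g x) :=
  fun K hK => (hf K hK).add (hg K hK)

lemma LocMemLp.mono {E E' : Type*} [NormedAddCommGroup E] [NormedAddCommGroup E'] {p : ℝ≥0∞}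
    {f : Space → E} {g : Space → E'} (hf : LocMemLp p f) (hg : AEStronglyMeasurable g) {C : ℝ}
    (h : ∀ᵐ x, ‖g x‖ ≤ C * ‖f x‖) : LocMemLp p g := fun K hK =>
  (hf K hK).of_le_mul hg.restrict (ae_restrict_of_ae h)

lemma locallyIntegrable_of_norm_le {E E' : Type*} [NormedAddCommGroup E] [NormedAddCommGroup E']
    {f : Space → E} {g : Space → E'} (hf : LocallyIntegrable f) (hg : AEStronglyMeasurable g)
    {C : ℝ} (h : ∀ᵐ x, ‖g x‖ ≤ C * ‖f x‖) : LocallyIntegrable g := by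
  refine locallyIntegrable_iff.2 fun K hK => ?_
  exact ((locallyIntegrable_iff.1 hf K hK).norm.const_mul C).mono' hg.restrict
    (ae_restrict_of_ae h)

lemma locallyIntegrable_const_mul_norm {E : Type*} [NormedAddCommGroup E] {f : Space → E}
    (hf : LocallyIntegrable f) (C : ℝ) : LocallyIntegrable (fun x => C * ‖f x‖) :=
  locallyIntegrable_of_norm_le hf (hf.aestronglyMeasurable.norm.const_mul C) (C := |C|)
    (ae_of_all _ fun x => by simp)

lemma aestronglyMeasurable_clm_apply {E : Type*} [NormedAddCommGroup E] [NormedSpace ℝ E]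
    {T : Space → E →L[ℝ] F} {v : Space → E} (hT : AEStronglyMeasurable T)
    (hv : AEStronglyMeasurable v) : AEStronglyMeasurable (fun x => T x (v x)) :=
  (ContinuousLinearMap.id ℝ (E →L[ℝ] F)).aestronglyMeasurable_comp₂ hT hv

lemma integrable_of_norm_le_of_eq_zero {E E' : Type*} [NormedAddCommGroup E]
    [NormedAddCommGroup E'] {b : Space → E} (hb : LocallyIntegrable b) {K : Set Space}
    (hK : IsCompact K) {w : Space → E'} (hw : AEStronglyMeasurable w) {C : ℝ}
    (hbound : ∀ᵐ x, x ∈ K → ‖w x‖ ≤ C * ‖b x‖) (hoff : ∀ x, x ∉ K → w x = 0) : Integrable w := by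
  have h : IntegrableOn w K :=
    Integrable.mono' ((locallyIntegrable_iff.1 hb K hK).norm.const_mul C) hw.restrict
      ((ae_restrict_iff' hK.measurableSet).2 hbound)
  refine (integrableOn_iff_integrable_of_support_subset fun x hx => ?_).1 h
  by_contra hxK
  exact hx (hoff x hxK)

lemma tendsto_integral_zero_of_norm_le {E : Type*} [NormedAddCommGroup E] {K : Set Space}
    {W : ℕ → Space → F} {X : ℕ → Space → E} {C : ℝ}
    (hX : Tendsto (fun n => eLpNorm (X n) 1 (volume.restrict K)) atTop (𝓝 0))
    (hle : ∀ n x, ‖W n x‖ ≤ C * ‖X n x‖) (hoff : ∀ n x, x ∉ K → W n x = 0) :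
    Tendsto (fun n => ∫ x, W n x) atTop (𝓝 0) := by
  rw [tendsto_zero_iff_enorm_tendsto_zero]
  have hC : Tendsto (fun n => ENNReal.ofReal C * eLpNorm (X n) 1 (volume.restrict K)) atTop
      (𝓝 0) := by
    simpa using ENNReal.Tendsto.const_mul hX (Or.inr ENNReal.ofReal_ne_top)
  refine tendsto_of_tendsto_of_tendsto_of_le_of_le tendsto_const_nhds hC (fun _ => zero_le)
    fun n => ?_
  have h1 : ∫ x, W n x = ∫ x in K, W n x :=
    (setIntegral_eq_integral_of_forall_compl_eq_zero (hoff n)).symm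
  dsimp only
  rw [h1, eLpNorm_one_eq_lintegral_enorm, ← lintegral_const_mul' _ _ ENNReal.ofReal_ne_top]
  refine (enorm_integral_le_lintegral_enorm _).trans (lintegral_mono fun x => ?_)
  by_cases hC0 : 0 ≤ C
  · rw [← ofReal_norm, ← ofReal_norm, ← ENNReal.ofReal_mul hC0]
    exact ENNReal.ofReal_le_ofReal (hle n x)
  · have : ‖W n x‖ ≤ 0 := (hle n x).trans
      (mul_nonpos_of_nonpos_of_nonneg (not_le.1 hC0).le (norm_nonneg _))
    rw [norm_le_zero_iff.1 this]; simp

/-! ### Test functions -/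

lemma IsTestFunction.continuous {U : Set Space} {φ : Space → F} (h : IsTestFunction U φ) :
    Continuous φ := h.smooth.continuous

lemma pderiv_contDiff {φ : Space → F} (h : ContDiff ℝ ∞ φ) (k : Fin 3) :
    ContDiff ℝ ∞ (pderiv k φ) :=
  (h.fderiv_right (m := ∞) (by simp)).clm_apply contDiff_const

lemma support_pderiv_subset {φ : Space → F} (k : Fin 3) :
    Function.support (pderiv k φ) ⊆ tsupport φ := by
  intro x hx
  refine support_fderiv_subset ℝ (f := φ) ?_
  intro h
  exact hx (by simp [pderiv, h])

lemma pderiv_eq_zero {φ : Space → F} (k : Fin 3) {x : Space} (hx : x ∉ tsupport φ) :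
    pderiv k φ x = 0 := by
  by_contra h
  exact hx (support_pderiv_subset k h)

lemma IsTestFunction.pderiv {U : Set Space} {φ : Space → F} (h : IsTestFunction U φ)
    (k : Fin 3) : IsTestFunction U (OneElectron.pderiv k φ) where
  smooth := pderiv_contDiff h.smooth k
  compact := h.compact.mono' (support_pderiv_subset k)
  subset := (closure_minimal (support_pderiv_subset k) (isClosed_tsupport φ)).trans h.subset

lemma IsTestFunction.exists_norm_le {U : Set Space} {φ : Space → F} (h : IsTestFunction U φ) :
    ∃ C, 0 ≤ C ∧ ∀ x, ‖φ x‖ ≤ C := by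
  obtain ⟨C, hC⟩ := h.compact.exists_bound_of_continuous h.continuous
  exact ⟨C, (norm_nonneg _).trans (hC 0), hC⟩

lemma IsTestFunction.mono {U V : Set Space} {φ : Space → F} (h : IsTestFunction U φ)
    (hUV : U ⊆ V) : IsTestFunction V φ := ⟨h.smooth, h.compact, h.subset.trans hUV⟩

lemma IsTestFunction.mul {U : Set Space} {φ ψ : Space → ℝ} (hφ : IsTestFunction U φ)
    (hψ : IsTestFunction univ ψ) : IsTestFunction U (fun x => ψ x * φ x) where
  smooth := hψ.smooth.mul hφ.smooth
  compact := hφ.compact.mul_left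
  subset := (closure_mono (Function.support_mul_subset_right _ _)).trans hφ.subset

lemma IsTestFunction.integrable_smul {U : Set Space} {φ : Space → ℝ} (hφ : IsTestFunction U φ)
    {f : Space → F} (hf : LocallyIntegrable f) : Integrable (fun x => φ x • f x) :=
  hf.integrable_smul_left_of_hasCompactSupport hφ.continuous hφ.compact

lemma pderiv_mul {φ ψ : Space → ℝ} (hφ : ContDiff ℝ ∞ φ) (hψ : ContDiff ℝ ∞ ψ) (k : Fin 3)
    (x : Space) : pderiv k (fun y => ψ y * φ y) x = pderiv k ψ x * φ x + ψ x * pderiv k φ x := by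
  rw [pderiv, fderiv_fun_mul (hψ.differentiable (by simp) x) (hφ.differentiable (by simp) x)]
  simp [pderiv]; ring

lemma pderiv_comm {φ : Space → ℝ} (hφ : ContDiff ℝ ∞ φ) (i k : Fin 3) (x : Space) :
    pderiv i (pderiv k φ) x = pderiv k (pderiv i φ) x := by
  have hd : DifferentiableAt ℝ (fderiv ℝ φ) x :=
    (hφ.fderiv_right (m := ∞) (by simp)).differentiable (by simp) x
  have h (k i : Fin 3) : pderiv i (pderiv k φ) x
      = fderiv ℝ (fderiv ℝ φ) x (EuclideanSpace.single i 1) (EuclideanSpace.single k 1) := by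
    rw [pderiv]
    change fderiv ℝ (fun y => fderiv ℝ φ y (EuclideanSpace.single k 1)) x _ = _
    rw [fderiv_clm_apply hd (differentiableAt_const _)]
    simp
  rw [h, h]
  exact ((contDiff_infty.1 hφ 2).contDiffAt.isSymmSndFDerivAt (by simp)).eq _ _

/-! ### Calculus of weak gradients -/

lemma isWeakGradient_of_hasFDerivAt {f : Space → F} {f' : Space → Space →L[ℝ] F}
    (hf : ∀ x, HasFDerivAt f (f' x) x) (hf' : Continuous f') :
    IsWeakGradient f (fun x k => f' x (EuclideanSpace.single k 1)) where
  locallyIntegrable :=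
    (continuous_iff_continuousAt.2 fun x => (hf x).continuousAt).locallyIntegrable
  locallyIntegrable_grad k := (hf'.clm_apply continuous_const).locallyIntegrable
  integral_eq φ hφ k := by
    have hfc : Continuous f := continuous_iff_continuousAt.2 fun x => (hf x).continuousAt
    have e (x : Space) : f' x = fderiv ℝ f x := (hf x).fderiv.symm
    simp only [e]
    refine integral_smul_fderiv_eq_neg_fderiv_smul_of_integrable ?_ ?_ ?_ ?_ ?_
    · exact (hφ.pderiv k).integrable_smul hfc.locallyIntegrable
    · simp only [← e]
      exact hφ.integrable_smul (hf'.clm_apply continuous_const).locallyIntegrable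
    · exact hφ.integrable_smul hfc.locallyIntegrable
    · exact fun x _ => hφ.smooth.differentiable (by simp) x
    · exact fun x _ => (hf x).differentiableAt

/-- The chain rule holds classically for the mollifications `fₙ`. To pass to the limit, `Φ'(fₙ)∇fₙ`
is split into `Φ'(fₙ)(∇fₙ - ∇f)`, which tends to `0` in `L¹` on the support of the test function,
and `Φ'(fₙ)∇f`, which converges by domination. Both steps use that `Φ'` is bounded. -/
lemma IsWeakGradient.comp {E : Type*} [NormedAddCommGroup E] [NormedSpace ℝ E] [CompleteSpace E]
    {f : Space → E} {G : Space → Fin 3 → E} (h : IsWeakGradient f G)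
    {Φ : E → F} {Φ' : E → E →L[ℝ] F} (hΦ : ∀ z, HasFDerivAt Φ (Φ' z) z) (hΦ' : Continuous Φ')
    {C : ℝ} (hC : ∀ z, ‖Φ' z‖ ≤ C) :
    IsWeakGradient (fun x => Φ (f x)) (fun x k => Φ' (f x) (G x k)) := by
  have hΦc : Continuous Φ := continuous_iff_continuousAt.2 fun x => (hΦ x).continuousAt
  have hlip (z w : E) : ‖Φ z - Φ w‖ ≤ C * ‖z - w‖ :=
    convex_univ.norm_image_sub_le_of_norm_hasFDerivWithin_le
      (fun x _ => (hΦ x).hasFDerivWithinAt) (fun x _ => hC x) (mem_univ _) (mem_univ _)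
  have hfm := h.locallyIntegrable.aestronglyMeasurable
  have hGm (k) := (h.locallyIntegrable_grad k).aestronglyMeasurable
  have hΦ'm (k) : AEStronglyMeasurable (fun x => Φ' (f x) (G x k)) :=
    aestronglyMeasurable_clm_apply (hΦ'.comp_aestronglyMeasurable hfm) (hGm k)
  have hgrad (k) : LocallyIntegrable (fun x => Φ' (f x) (G x k)) :=
    locallyIntegrable_of_norm_le (h.locallyIntegrable_grad k) (hΦ'm k)
      (ae_of_all _ fun x => (Φ' (f x)).le_of_opNorm_le (hC _) _)
  have hloc : LocallyIntegrable (fun x => Φ (f x)) := by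
    have h1 : LocallyIntegrable (fun x => Φ (f x) - Φ 0) :=
      locallyIntegrable_of_norm_le h.locallyIntegrable
        ((hΦc.comp_aestronglyMeasurable hfm).sub aestronglyMeasurable_const)
        (ae_of_all _ fun x => by simpa using hlip (f x) 0)
    have h2 := h1.add (locallyIntegrable_const (Φ 0))
    simp only [Pi.add_def, sub_add_cancel] at h2
    exact h2
  refine ⟨hloc, hgrad, fun φ hφ k => ?_⟩
  have hK : IsCompact (tsupport φ) := hφ.compact
  obtain ⟨M, hM0, hM⟩ := hφ.exists_norm_le
  obtain ⟨M', hM'0, hM'⟩ := (hφ.pderiv k).exists_norm_le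
  have hC0 : 0 ≤ C := (norm_nonneg _).trans (hC 0)
  have hsm (n : ℕ) := mollify_contDiff n h.locallyIntegrable
  have hmc (n : ℕ) := (hsm n).continuous
  have hpar (n : ℕ) : ∫ x, φ x • Φ' (mollify n f x) (pderiv k (mollify n f) x)
      = -∫ x, pderiv k φ x • Φ (mollify n f x) :=
    (isWeakGradient_of_hasFDerivAt
      (f' := fun x => (Φ' (mollify n f x)).comp (fderiv ℝ (mollify n f) x))
      (fun x => (hΦ _).comp x ((hsm n).differentiable (by simp) x).hasFDerivAt)
      ((hΦ'.comp (hmc n)).clm_comp ((hsm n).continuous_fderiv (by simp)))).integral_eq φ hφ k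
  have hright : Tendsto (fun n => ∫ x, pderiv k φ x • Φ (mollify n f x)) atTop
      (𝓝 (∫ x, pderiv k φ x • Φ (f x))) := by
    rw [← tendsto_sub_nhds_zero_iff]
    have := tendsto_integral_zero_of_norm_le (C := M' * C)
      (W := fun n x => pderiv k φ x • (Φ (mollify n f x) - Φ (f x)))
      ((locMemLp_one_of_locallyIntegrable h.locallyIntegrable).tendsto_mollify (by simp) hK)
      (fun n x => by
        rw [norm_smul, mul_assoc]
        exact mul_le_mul (hM' x) (hlip _ _) (norm_nonneg _) hM'0)
      (fun n x hx => by rw [pderiv_eq_zero k hx, zero_smul])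
    refine this.congr fun n => ?_
    simp only [smul_sub]
    exact integral_sub ((hφ.pderiv k).integrable_smul (hΦc.comp (hmc n)).locallyIntegrable)
      ((hφ.pderiv k).integrable_smul hloc)
  have hmid : Tendsto (fun n => ∫ x, φ x • Φ' (mollify n f x) (G x k)) atTop
      (𝓝 (∫ x, φ x • Φ' (f x) (G x k))) := by
    refine tendsto_integral_of_dominated_convergence (fun x => ‖φ x • (C * ‖G x k‖)‖)
      (fun n => ?_) ?_ (fun n => ae_of_all _ fun x => ?_) ?_
    · exact hφ.continuous.aestronglyMeasurable.smul
        (aestronglyMeasurable_clm_apply (hΦ'.comp (hmc n)).aestronglyMeasurable (hGm k))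
    · exact (hφ.integrable_smul (locallyIntegrable_const_mul_norm (h.locallyIntegrable_grad k) C)).norm
    · rw [norm_smul, norm_smul, Real.norm_of_nonneg (mul_nonneg hC0 (norm_nonneg (G x k)))]
      gcongr
      exact (Φ' _).le_of_opNorm_le (hC _) _
    · filter_upwards [ae_tendsto_mollify h.locallyIntegrable] with x hx
      exact (((hΦ'.clm_apply continuous_const).tendsto (f x)).comp hx).const_smul _
  have hleft : Tendsto (fun n => ∫ x, φ x • Φ' (mollify n f x) (pderiv k (mollify n f) x)) atTop
      (𝓝 (∫ x, φ x • Φ' (f x) (G x k))) := by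
    have h0 := tendsto_integral_zero_of_norm_le (C := M * C)
      (W := fun n x => φ x • Φ' (mollify n f x) (mollify n (fun y => G y k) x - G x k))
      ((locMemLp_one_of_locallyIntegrable (h.locallyIntegrable_grad k)).tendsto_mollify
        (by simp) hK)
      (fun n x => by
        rw [norm_smul, mul_assoc]
        exact mul_le_mul (hM x) ((Φ' _).le_of_opNorm_le (hC _) _) (norm_nonneg _) hM0)
      (fun n x hx => by rw [image_eq_zero_of_notMem_tsupport hx, zero_smul])
    have h1 := h0.add hmid
    rw [zero_add] at h1
    refine h1.congr fun n => ?_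
    rw [← integral_add]
    · refine integral_congr_ae (ae_of_all _ fun x => ?_)
      simp only [← smul_add, ← map_add, sub_add_cancel, h.pderiv_mollify]
    · simp only [map_sub, smul_sub]
      refine Integrable.sub (hφ.integrable_smul ?_) (hφ.integrable_smul ?_)
      · exact ((hΦ'.comp (hmc n)).clm_apply
          (mollify_contDiff n (h.locallyIntegrable_grad k)).continuous).locallyIntegrable
      · exact locallyIntegrable_of_norm_le (h.locallyIntegrable_grad k)
          (aestronglyMeasurable_clm_apply (hΦ'.comp (hmc n)).aestronglyMeasurable (hGm k))
          (ae_of_all _ fun x => (Φ' _).le_of_opNorm_le (hC _) _)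
    · exact hφ.integrable_smul (locallyIntegrable_of_norm_le (h.locallyIntegrable_grad k)
          (aestronglyMeasurable_clm_apply (hΦ'.comp (hmc n)).aestronglyMeasurable (hGm k))
          (ae_of_all _ fun x => (Φ' _).le_of_opNorm_le (hC _) _))
  exact tendsto_nhds_unique hleft ((hright.neg).congr fun n => (hpar n).symm)

lemma IsWeakGradient.smul_test {f : Space → F} {G : Space → Fin 3 → F} (h : IsWeakGradient f G)
    {φ : Space → ℝ} (hφ : IsTestFunction univ φ) :
    IsWeakGradient (fun x => φ x • f x) (fun x k => pderiv k φ x • f x + φ x • G x k) where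
  locallyIntegrable := (hφ.integrable_smul h.locallyIntegrable).locallyIntegrable
  locallyIntegrable_grad k := (((hφ.pderiv k).integrable_smul h.locallyIntegrable).add
    (hφ.integrable_smul (h.locallyIntegrable_grad k))).locallyIntegrable
  integral_eq ψ hψ k := by
    have h1 := h.integral_eq _ (hφ.mul hψ) k
    have hi1 : Integrable fun x => (ψ x * pderiv k φ x) • f x :=
      ((hφ.pderiv k).mul hψ).integrable_smul h.locallyIntegrable
    have hi2 : Integrable fun x => (ψ x * φ x) • G x k :=
      (hφ.mul hψ).integrable_smul (h.locallyIntegrable_grad k)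
    have hi3 : Integrable fun x => (pderiv k ψ x * φ x) • f x :=
      (hφ.mul (hψ.pderiv k)).integrable_smul h.locallyIntegrable
    simp only [pderiv_mul hφ.smooth hψ.smooth, add_smul] at h1
    rw [integral_add hi3 hi1] at h1
    simp only [smul_add, smul_smul]
    rw [integral_add hi1 hi2, h1]
    abel

/-- A bounded function with support in the ball of radius `R` and square-integrable weak
gradient. -/
structure IsSobolevTest (R M : ℝ) (f : Space → F) (G : Space → Fin 3 → F) : Prop where
  isWeakGradient : IsWeakGradient f G
  norm_le : ∀ x, ‖f x‖ ≤ M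
  eq_zero : ∀ x, R < ‖x‖ → f x = 0
  grad_eq_zero : ∀ x, R < ‖x‖ → ∀ k, G x k = 0
  locMemLp : ∀ k, LocMemLp 2 (fun x => G x k)

/-! ### Extending weak identities from smooth to bounded Sobolev test functions -/

namespace IsSobolevTest

variable {E W : Type*} [NormedAddCommGroup E] [NormedSpace ℝ E] [NormedAddCommGroup W]
  [NormedSpace ℝ W] {R M : ℝ} {f : Space → F} {G : Space → Fin 3 → F}

lemma isTestFunction_mollify (h : IsSobolevTest R M f G) (n : ℕ) :
    IsTestFunction univ (mollify n f) where
  smooth := mollify_contDiff n h.isWeakGradient.locallyIntegrable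
  compact := HasCompactSupport.intro (isCompact_closedBall (0 : Space) (R + 1)) fun x hx =>
    mollify_eq_zero n h.eq_zero (by simpa using hx)
  subset := subset_univ _

/-- Mollification preserves the bound `M`, so domination works against a merely locally integrable
`b`. This is why boundedness is part of `IsSobolevTest`. -/
lemma tendsto_integral [CompleteSpace F] (h : IsSobolevTest R M f G) (L : F →L[ℝ] E →L[ℝ] W)
    {b : Space → E} (hb : LocallyIntegrable b) :
    Tendsto (fun n => ∫ x, L (mollify n f x) (b x)) atTop (𝓝 (∫ x, L (f x) (b x))) := by
  have hK := isCompact_closedBall (0 : Space) (R + 1)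
  have hM : 0 ≤ M := (norm_nonneg _).trans (h.norm_le 0)
  refine tendsto_integral_of_dominated_convergence
    ((Metric.closedBall (0 : Space) (R + 1)).indicator fun x => ‖L‖ * M * ‖b x‖)
    (fun n => ?_) ?_ (fun n => ae_of_all _ fun x => ?_) ?_
  · exact L.aestronglyMeasurable_comp₂ (h.isTestFunction_mollify n).continuous.aestronglyMeasurable
      hb.aestronglyMeasurable
  · exact (integrable_indicator_iff hK.measurableSet).2
      ((locallyIntegrable_iff.1 hb _ hK).norm.const_mul _)
  · by_cases hx : x ∈ Metric.closedBall (0 : Space) (R + 1)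
    · rw [indicator_of_mem hx]
      refine (L.le_opNorm₂ _ _).trans ?_
      gcongr
      exact norm_mollify_le n h.norm_le x
    · rw [indicator_of_notMem hx, mollify_eq_zero n h.eq_zero (by simpa using hx)]
      simp
  · filter_upwards [ae_tendsto_mollify h.isWeakGradient.locallyIntegrable] with x hx
    exact ((L.flip (b x)).continuous.tendsto _).comp hx

/-- No bound on the gradient is available here; instead `∇fₙ → ∇f` in `L²` on a ball, and
Cauchy–Schwarz pairs this with `a` in `L²_loc`. -/
lemma tendsto_integral_pderiv [CompleteSpace F] (h : IsSobolevTest R M f G)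
    (L : F →L[ℝ] E →L[ℝ] W) {a : Space → E} (ha : LocMemLp 2 a) (k : Fin 3) :
    Tendsto (fun n => ∫ x, L (pderiv k (mollify n f) x) (a x)) atTop
      (𝓝 (∫ x, L (G x k) (a x))) := by
  have hK := isCompact_closedBall (0 : Space) (R + 1)
  set K := Metric.closedBall (0 : Space) (R + 1)
  have ham := ha.locallyIntegrable.aestronglyMeasurable
  have hGm := (h.isWeakGradient.locallyIntegrable_grad k).aestronglyMeasurable
  have hmm (n : ℕ) : AEStronglyMeasurable (mollify n fun y => G y k) :=
    (mollify_contDiff n (h.isWeakGradient.locallyIntegrable_grad k)).continuous.aestronglyMeasurable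
  have hoffG (x) (hx : x ∉ K) : G x k = 0 := by
    refine h.grad_eq_zero x ?_ k
    have : R + 1 < ‖x‖ := by simpa [K] using hx
    linarith
  have hoffm (n x) (hx : x ∉ K) : mollify n (fun y => G y k) x = 0 :=
    mollify_eq_zero n (fun y hy => h.grad_eq_zero y hy k) (by simpa [K] using hx)
  have hmL2 (n) : MemLp (mollify n fun y => G y k) 2 (volume.restrict K) := by
    have : IsFiniteMeasure (volume.restrict K) := ⟨by simpa using hK.measure_lt_top⟩
    obtain ⟨C, hC⟩ := hK.exists_bound_of_continuousOn
      (mollify_contDiff n (h.isWeakGradient.locallyIntegrable_grad k)).continuous.continuousOn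
    exact MemLp.of_bound (hmm n).restrict C ((ae_restrict_iff' hK.measurableSet).2
      (ae_of_all _ hC))
  have hint {g : Space → F} (hg : MemLp g 2 (volume.restrict K)) (hoff : ∀ x ∉ K, g x = 0) :
      Integrable fun x => L (g x) (a x) := by
    refine (integrableOn_iff_integrable_of_support_subset (s := K) fun x hx => ?_).1 ?_
    · by_contra hxK
      exact hx (by simp [hoff x hxK])
    · refine memLp_one_iff_integrable.1 (MemLp.of_bilin (fun y z => L y z) ‖L‖₊ hg (ha K hK)
        (L.aestronglyMeasurable_comp₂ hg.1 (ha K hK).1) (ae_of_all _ fun x => ?_))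
      exact L.le_opNorm₂ _ _
  simp only [h.isWeakGradient.pderiv_mollify]
  rw [← tendsto_sub_nhds_zero_iff]
  have hX : Tendsto (fun n => eLpNorm (fun x => ‖mollify n (fun y => G y k) x - G x k‖ * ‖a x‖) 1
      (volume.restrict K)) atTop (𝓝 0) := by
    have h1 := ENNReal.Tendsto.mul_const ((h.locMemLp k).tendsto_mollify (by simp) hK)
      (Or.inr (ha K hK).eLpNorm_ne_top)
    rw [zero_mul] at h1
    refine tendsto_of_tendsto_of_tendsto_of_le_of_le tendsto_const_nhds h1 (fun _ => zero_le)
      fun n => ?_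
    have := eLpNorm_le_eLpNorm_mul_eLpNorm_of_nnnorm (p := 2) (q := 2) (r := 1)
      (μ := volume.restrict K) ((hmm n).sub hGm).restrict ham.restrict
      (fun y z => ‖y‖ * ‖z‖) 1 (ae_of_all _ fun x => by simp)
    rw [ENNReal.coe_one, one_mul] at this
    exact this
  refine (tendsto_integral_zero_of_norm_le (C := ‖L‖)
    (W := fun n x => L (mollify n (fun y => G y k) x - G x k) (a x)) hX (fun n x => ?_)
    (fun n x hx => ?_)).congr fun n => ?_
  · rw [norm_mul, norm_norm, norm_norm, ← mul_assoc]
    exact L.le_opNorm₂ _ _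
  · simp [hoffm n x hx, hoffG x hx]
  · simp only [map_sub, sub_apply]
    exact integral_sub (hint (hmL2 n) (hoffm n)) (hint (h.locMemLp k K hK) hoffG)

end IsSobolevTest

lemma IsWeakGradient.isSobolevTest_smul {f : Space → F} {G : Space → Fin 3 → F}
    (h : IsWeakGradient f G) {M : ℝ} (hM : ∀ x, ‖f x‖ ≤ M) (hG : ∀ k, LocMemLp 2 (fun x => G x k))
    {φ : Space → ℝ} (hφ : IsTestFunction univ φ) :
    ∃ R M', IsSobolevTest R M' (fun x => φ x • f x)
      (fun x k => pderiv k φ x • f x + φ x • G x k) := by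
  obtain ⟨R, hR0, hR⟩ := exists_norm_le_of_isCompact hφ.compact
  obtain ⟨C, hC0, hC⟩ := hφ.exists_norm_le
  have hoff (x : Space) (hx : R < ‖x‖) : x ∉ tsupport φ := fun h => absurd (hR x h) (not_le.2 hx)
  have hM0 : 0 ≤ M := (norm_nonneg _).trans (hM 0)
  have hfm := h.locallyIntegrable.aestronglyMeasurable
  refine ⟨R, C * M, h.smul_test hφ, fun x => ?_, fun x hx => ?_, fun x hx k => ?_, fun k => ?_⟩
  · rw [norm_smul]
    exact mul_le_mul (hC x) (hM x) (norm_nonneg _) hC0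
  · rw [image_eq_zero_of_notMem_tsupport (hoff x hx), zero_smul]
  · rw [image_eq_zero_of_notMem_tsupport (hoff x hx), pderiv_eq_zero k (hoff x hx)]
    simp
  · obtain ⟨C', hC'0, hC'⟩ := (hφ.pderiv k).exists_norm_le
    refine LocMemLp.add (fun K hK => ?_) ((hG k).mono (C := C) ?_ (ae_of_all _ fun x => ?_))
    · have : IsFiniteMeasure (volume.restrict K) := ⟨by simpa using hK.measure_lt_top⟩
      refine MemLp.of_bound ((hφ.pderiv k).continuous.aestronglyMeasurable.smul hfm).restrict
        (C' * M) (ae_of_all _ fun x => ?_)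
      rw [norm_smul]
      exact mul_le_mul (hC' x) (hM x) (norm_nonneg _) hC'0
    · exact hφ.continuous.aestronglyMeasurable.smul
        (h.locallyIntegrable_grad k).aestronglyMeasurable
    · rw [norm_smul]
      exact mul_le_mul_of_nonneg_right (hC x) (norm_nonneg _)

lemma IsSobolevTest.integrable_mul {R M : ℝ} {f : Space → ℝ} {G : Space → Fin 3 → ℝ}
    (h : IsSobolevTest R M f G) {a : Space → ℝ} (ha : LocMemLp 2 a) (k : Fin 3) :
    Integrable fun x => G x k * a x := by
  have hK := isCompact_closedBall (0 : Space) R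
  refine (integrableOn_iff_integrable_of_support_subset (s := Metric.closedBall (0 : Space) R)
    fun x hx => ?_).1 ((h.locMemLp k _ hK).integrable_mul (ha _ hK))
  by_contra hxK
  exact hx (by simp [h.grad_eq_zero x (by simpa using hxK) k])

/-- The product rule `∇ × (p A) = p ∇ × A + ∇p × A`. -/
lemma integral_curl_mul {p : Space → ℝ} {dp A B : Space → Fin 3 → ℝ} (hp : IsWeakGradient p dp)
    {M : ℝ} (hM : ∀ x, ‖p x‖ ≤ M) (hdp : ∀ k, LocMemLp 2 (fun x => dp x k))
    (hA : ∀ k, LocMemLp 2 (fun x => A x k)) (hB : ∀ k, LocallyIntegrable (fun x => B x k))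
    (hcurl : ∀ φ : Space → ℝ, IsTestFunction univ φ → ∀ k : Fin 3, ∫ x, φ x * B x k
      = -∫ x, (pderiv (k + 1) φ x * A x (k + 2) - pderiv (k + 2) φ x * A x (k + 1)))
    {φ : Space → ℝ} (hφ : IsTestFunction univ φ) (k : Fin 3) :
    Integrable (fun x => (pderiv (k + 1) φ x * p x + φ x * dp x (k + 1)) * A x (k + 2)
        - (pderiv (k + 2) φ x * p x + φ x * dp x (k + 2)) * A x (k + 1)) ∧
    ∫ x, φ x * (p x * B x k) =
      -∫ x, ((pderiv (k + 1) φ x * p x + φ x * dp x (k + 1)) * A x (k + 2)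
        - (pderiv (k + 2) φ x * p x + φ x * dp x (k + 2)) * A x (k + 1)) := by
  -- The weak curl of `A` is tested with the mollifications of `φ p`: boundedness of `p` controls
  -- the term with `B`, and square-integrability of `∇p` the terms with `A`.
  obtain ⟨R, M', hf⟩ := hp.isSobolevTest_smul hM hdp hφ
  simp only [smul_eq_mul] at hf
  have h1 := hf.tendsto_integral (ContinuousLinearMap.mul ℝ ℝ) (hB k)
  have h2 := hf.tendsto_integral_pderiv (ContinuousLinearMap.mul ℝ ℝ) (hA (k + 2)) (k + 1)
  have h3 := hf.tendsto_integral_pderiv (ContinuousLinearMap.mul ℝ ℝ) (hA (k + 1)) (k + 2)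
  simp only [ContinuousLinearMap.mul_apply', mul_assoc] at h1
  simp only [ContinuousLinearMap.mul_apply'] at h2 h3
  refine ⟨(hf.integrable_mul (hA _) _).sub (hf.integrable_mul (hA _) _),
    tendsto_nhds_unique h1 ?_⟩
  rw [integral_sub (hf.integrable_mul (hA _) _) (hf.integrable_mul (hA _) _)]
  refine (h2.sub h3).neg.congr fun n => ?_
  have ht := hf.isTestFunction_mollify n
  rw [hcurl _ ht k, integral_sub]
  · exact (ht.pderiv _).integrable_smul (hA _).locallyIntegrable
  · exact (ht.pderiv _).integrable_smul (hA _).locallyIntegrable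

/-- A gradient is curl-free. -/
lemma IsWeakGradient.integral_curl_eq_zero {q : Space → ℝ} {dq : Space → Fin 3 → ℝ}
    (hq : IsWeakGradient q dq) {φ : Space → ℝ} (hφ : IsTestFunction univ φ) (a b : Fin 3) :
    ∫ x, (pderiv a φ x * dq x b - pderiv b φ x * dq x a) = 0 := by
  have h1 := hq.integral_eq _ (hφ.pderiv a) b
  have h2 := hq.integral_eq _ (hφ.pderiv b) a
  simp only [smul_eq_mul, pderiv_comm hφ.smooth b a] at h1 h2
  have hi (i k : Fin 3) : Integrable fun x => pderiv i φ x * dq x k :=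
    (hφ.pderiv i).integrable_smul (hq.locallyIntegrable_grad k)
  rw [integral_sub (hi a b) (hi b a), h1, h2, sub_self]

/-! ### The regularized phase -/

/-- `(δ + |z|²)^{-1/2}`. -/
def invSqrt (δ : ℝ) (z : ℂ) : ℝ := (√(δ + ‖z‖ ^ 2))⁻¹

/-- The regularized phase `z / (δ + |z|²)^{1/2}`. -/
def phase (δ : ℝ) (z : ℂ) : ℂ := invSqrt δ z • z

/-- The real derivative of `phase δ`. -/
def phaseDeriv (δ : ℝ) (z : ℂ) : ℂ →L[ℝ] ℂ :=
  invSqrt δ z • ContinuousLinearMap.id ℝ ℂ - (invSqrt δ z ^ 3) • (innerSL ℝ z).smulRight z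

lemma phaseDeriv_apply (δ : ℝ) (z ζ : ℂ) : phaseDeriv δ z ζ
    = invSqrt δ z • ζ - invSqrt δ z ^ 3 • (inner ℝ z ζ : ℝ) • z := rfl

section Phase

variable {δ : ℝ} (hδ : 0 < δ)
include hδ

lemma add_norm_sq_pos (z : ℂ) : 0 < δ + ‖z‖ ^ 2 := by positivity

lemma invSqrt_pos (z : ℂ) : 0 < invSqrt δ z :=
  inv_pos.2 (Real.sqrt_pos.2 (add_norm_sq_pos hδ z))

lemma invSqrt_sq (z : ℂ) : invSqrt δ z ^ 2 = (δ + ‖z‖ ^ 2)⁻¹ := by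
  rw [invSqrt, inv_pow, Real.sq_sqrt (add_norm_sq_pos hδ z).le]

lemma invSqrt_mul_norm_le (z : ℂ) : invSqrt δ z * ‖z‖ ≤ 1 := by
  rw [invSqrt, inv_mul_le_iff₀ (Real.sqrt_pos.2 (add_norm_sq_pos hδ z)), mul_one]
  exact Real.le_sqrt_of_sq_le (by linarith)

lemma invSqrt_le (z : ℂ) : invSqrt δ z ≤ (√δ)⁻¹ :=
  inv_anti₀ (Real.sqrt_pos.2 hδ) (Real.sqrt_le_sqrt (by linarith [sq_nonneg ‖z‖]))

lemma norm_phase_le (z : ℂ) : ‖phase δ z‖ ≤ 1 := by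
  rw [phase, norm_smul, Real.norm_of_nonneg (invSqrt_pos hδ z).le]
  exact invSqrt_mul_norm_le hδ z

/-- The decaying factor `invSqrt δ z` is essential: multiplied by `|z|` it stays bounded, which is
what tames `Aψ` inside `∇ψ`. -/
lemma norm_phaseDeriv_le (z : ℂ) : ‖phaseDeriv δ z‖ ≤ 2 * invSqrt δ z := by
  have hg := (invSqrt_pos hδ z).le
  have h1 : (invSqrt δ z * ‖z‖) ^ 2 ≤ 1 :=
    pow_le_one₀ (mul_nonneg hg (norm_nonneg _)) (invSqrt_mul_norm_le hδ z)
  refine ContinuousLinearMap.opNorm_le_bound _ (by linarith) fun ζ => ?_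
  have h2 : ‖(inner ℝ z ζ : ℝ)‖ ≤ ‖z‖ * ‖ζ‖ := norm_inner_le_norm z ζ
  calc ‖phaseDeriv δ z ζ‖ = ‖invSqrt δ z • ζ - (invSqrt δ z ^ 3) • (inner ℝ z ζ : ℝ) • z‖ := rfl
    _ ≤ invSqrt δ z * ‖ζ‖ + invSqrt δ z ^ 3 * ((‖z‖ * ‖ζ‖) * ‖z‖) := by
        refine (norm_sub_le _ _).trans ?_
        rw [norm_smul, norm_smul, norm_smul, Real.norm_of_nonneg hg,
          Real.norm_of_nonneg (pow_nonneg hg 3)]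
        gcongr
    _ = invSqrt δ z * ‖ζ‖ * (1 + (invSqrt δ z * ‖z‖) ^ 2) := by ring
    _ ≤ invSqrt δ z * ‖ζ‖ * 2 := by gcongr; linarith
    _ = _ := by ring

lemma norm_phaseDeriv_le' (z : ℂ) : ‖phaseDeriv δ z‖ ≤ 2 * (√δ)⁻¹ :=
  (norm_phaseDeriv_le hδ z).trans (by linarith [invSqrt_le hδ z])

lemma continuous_invSqrt : Continuous (invSqrt δ) :=
  Continuous.inv₀ (by fun_prop) fun z => (Real.sqrt_pos.2 (add_norm_sq_pos hδ z)).ne'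

lemma continuous_phase : Continuous (phase δ) := (continuous_invSqrt hδ).smul continuous_id

lemma continuous_phaseDeriv : Continuous (phaseDeriv δ) := by
  have := continuous_invSqrt hδ
  refine (this.smul continuous_const).sub ((this.pow 3).smul ?_)
  have h : Continuous fun z : ℂ => ContinuousLinearMap.smulRightL ℝ ℂ ℂ (innerSL ℝ z) z :=
    ((ContinuousLinearMap.smulRightL ℝ ℂ ℂ).continuous.comp (innerSL ℝ).continuous).clm_apply
      continuous_id
  exact h

lemma hasFDerivAt_phase (z : ℂ) : HasFDerivAt (phase δ) (phaseDeriv δ z) z := by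
  have hpos := add_norm_sq_pos hδ z
  have hs := (Real.sqrt_pos.2 hpos).ne'
  have h1 : HasDerivAt (fun t : ℝ => (√t)⁻¹) (-(1 / (2 * √(δ + ‖z‖ ^ 2))) /
      √(δ + ‖z‖ ^ 2) ^ 2) (δ + ‖z‖ ^ 2) := (Real.hasDerivAt_sqrt hpos.ne').inv hs
  have h2 : HasFDerivAt (fun z : ℂ => δ + ‖z‖ ^ 2) (2 • innerSL ℝ z) z :=
    (hasStrictFDerivAt_norm_sq z).hasFDerivAt.const_add δ
  have h3 := (h1.comp_hasFDerivAt z h2).smul (hasFDerivAt_id z)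
  refine h3.congr_fderiv ?_
  refine ContinuousLinearMap.ext fun ζ => ?_
  have hc : -(1 / (2 * √(δ + ‖z‖ ^ 2))) / √(δ + ‖z‖ ^ 2) ^ 2 * (2 * inner ℝ z ζ)
      = -(invSqrt δ z ^ 3 * inner ℝ z ζ) := by
    rw [invSqrt]; field_simp
  rw [phaseDeriv_apply, smul_smul, sub_eq_add_neg, ← neg_smul, ← hc]
  simp [invSqrt]
  exact Or.inl (Or.inl (by ring))

end Phase

/-! ### States -/

lemma IsVectorPotential.locMemLp {A B : Space → Space} (h : IsVectorPotential A B) (k : Fin 3) :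
    LocMemLp 2 (fun x => A x k) := fun K hK => (h.memLp_two_loc K hK).eval_piLp k

lemma locallyIntegrable_apply {B : Space → Space} (h : LocallyIntegrable B) (k : Fin 3) :
    LocallyIntegrable (fun x => B x k) :=
  locallyIntegrable_iff.2 fun K hK => integrable_piLp_iff.1 (locallyIntegrable_iff.1 h K hK) k

lemma IsVectorPotential.locallyIntegrable_curl {A B : Space → Space} (h : IsVectorPotential A B)
    (k : Fin 3) : LocallyIntegrable (fun x => B x k) :=
  locallyIntegrable_apply (locallyIntegrableOn_univ.1 h.curl.locallyIntegrableOn_curl) k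

namespace State

variable {A : Space → Space} (s : State A)

/-- Half of the density gradient, `Re (ψ* ∇ψ)`. -/
def halfGradDensity (x : Space) (k : Fin 3) : ℝ := (conj (s.ψ x) * s.grad x k).re

/-- The kinetic momentum `(-i∇ + A) ψ`. -/
def momentum (x : Space) (k : Fin 3) : ℂ := -Complex.I * s.grad x k + (A x k : ℂ) * s.ψ x

lemma density_eq (x : Space) : s.density x = (s.ψ x).re ^ 2 + (s.ψ x).im ^ 2 := by
  rw [density, Complex.sq_norm, Complex.normSq_apply]; ring

lemma halfGradDensity_eq (x : Space) (k : Fin 3) : s.halfGradDensity x k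
    = (s.ψ x).re * (s.grad x k).re + (s.ψ x).im * (s.grad x k).im := by
  simp [halfGradDensity]

lemma totalCurrent_apply (x : Space) (k : Fin 3) : s.totalCurrent x k
    = (s.ψ x).re * (s.grad x k).im - (s.ψ x).im * (s.grad x k).re + s.density x * A x k := by
  simp [totalCurrent, paramagneticCurrent]; ring

/-- The components satisfy `ψ* π = j - iσ`; take squared moduli. -/
lemma sq_add_sq_eq (x : Space) (k : Fin 3) :
    s.totalCurrent x k ^ 2 + s.halfGradDensity x k ^ 2
      = s.density x * ‖s.momentum x k‖ ^ 2 := by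
  rw [Complex.sq_norm, Complex.normSq_apply, totalCurrent_apply, halfGradDensity_eq, density_eq]
  simp [momentum]; ring

lemma aestronglyMeasurable : AEStronglyMeasurable s.ψ := s.memLp.1

lemma aestronglyMeasurable_density : AEStronglyMeasurable s.density :=
  s.aestronglyMeasurable.norm.pow 2

lemma aestronglyMeasurable_grad (k : Fin 3) : AEStronglyMeasurable (fun x => s.grad x k) :=
  (s.isWeakGradient.locallyIntegrable_grad k).aestronglyMeasurable

lemma memLp_momentum (k : Fin 3) : MemLp (fun x => s.momentum x k) 2 := s.kinetic k

lemma aestronglyMeasurable_halfGradDensity (k : Fin 3) :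
    AEStronglyMeasurable (fun x => s.halfGradDensity x k) :=
  Complex.continuous_re.comp_aestronglyMeasurable
    ((Complex.continuous_conj.comp_aestronglyMeasurable s.aestronglyMeasurable).mul
      (s.aestronglyMeasurable_grad k))

lemma aestronglyMeasurable_totalCurrent (hA : ∀ k, LocMemLp 2 (fun x => A x k)) (k : Fin 3) :
    AEStronglyMeasurable (fun x => s.totalCurrent x k) := by
  have h1 : AEStronglyMeasurable (fun x => (conj (s.ψ x) * s.grad x k).im) :=
    Complex.continuous_im.comp_aestronglyMeasurable
    ((Complex.continuous_conj.comp_aestronglyMeasurable s.aestronglyMeasurable).mul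
      (s.aestronglyMeasurable_grad k))
  refine (h1.add (s.aestronglyMeasurable_density.mul
    (hA k).locallyIntegrable.aestronglyMeasurable)).congr (ae_of_all _ fun x => ?_)
  simp [totalCurrent, paramagneticCurrent]

/-- Pointwise form of `∇(φm) × A + ∇(φp) × ∇q - ∇(φq) × ∇p`, rewritten through `j` and `σ`. Here `X
+ iY = ψ`, `r` and `i` are the real and imaginary parts of `∇ψ`, `α` is `A`, `D` is `∇φ`, and `g =
(δ + ρ)^{-1/2}`. -/
lemma regularized_curl_identity {δ X Y ra rb ia ib αa αb D₁ D₂ φ g : ℝ} (hr : X ^ 2 + Y ^ 2 ≠ 0)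
    (hd : δ + (X ^ 2 + Y ^ 2) ≠ 0) (hg : g ^ 2 = (δ + (X ^ 2 + Y ^ 2))⁻¹) :
    (D₁ * ((X ^ 2 + Y ^ 2) / (δ + (X ^ 2 + Y ^ 2)))
          + φ * (2 * (δ / (δ + (X ^ 2 + Y ^ 2)) ^ 2 * (X * ra + Y * ia)))) * αb
        - (D₂ * ((X ^ 2 + Y ^ 2) / (δ + (X ^ 2 + Y ^ 2)))
          + φ * (2 * (δ / (δ + (X ^ 2 + Y ^ 2)) ^ 2 * (X * rb + Y * ib)))) * αa
      + ((D₁ * (g * X) + φ * (g * ra - g ^ 3 * (X * ra + Y * ia) * X))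
            * (g * ib - g ^ 3 * (X * rb + Y * ib) * Y)
          - (D₂ * (g * X) + φ * (g * rb - g ^ 3 * (X * rb + Y * ib) * X))
            * (g * ia - g ^ 3 * (X * ra + Y * ia) * Y))
      - ((D₁ * (g * Y) + φ * (g * ia - g ^ 3 * (X * ra + Y * ia) * Y))
            * (g * rb - g ^ 3 * (X * rb + Y * ib) * X)
          - (D₂ * (g * Y) + φ * (g * ib - g ^ 3 * (X * rb + Y * ib) * Y))
            * (g * ra - g ^ 3 * (X * ra + Y * ia) * X))
    = (D₁ * (X * ib - Y * rb + (X ^ 2 + Y ^ 2) * αb)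
          - D₂ * (X * ia - Y * ra + (X ^ 2 + Y ^ 2) * αa)) / (δ + (X ^ 2 + Y ^ 2))
      + φ * (2 * (δ / (δ + (X ^ 2 + Y ^ 2)) ^ 2)
        * (((X * ra + Y * ia) * (X * ib - Y * rb + (X ^ 2 + Y ^ 2) * αb)
          - (X * rb + Y * ib) * (X * ia - Y * ra + (X ^ 2 + Y ^ 2) * αa)) / (X ^ 2 + Y ^ 2))) := by
  -- Every product pairs a component of `u` or `∇u` with another, so only even powers of `g` survive
  -- and the square root disappears.
  have e : (D₁ * (g * X) + φ * (g * ra - g ^ 3 * (X * ra + Y * ia) * X))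
            * (g * ib - g ^ 3 * (X * rb + Y * ib) * Y)
          - (D₂ * (g * X) + φ * (g * rb - g ^ 3 * (X * rb + Y * ib) * X))
            * (g * ia - g ^ 3 * (X * ra + Y * ia) * Y)
      = (D₁ * (g * Y) + φ * (g * ia - g ^ 3 * (X * ra + Y * ia) * Y))
            * (g * rb - g ^ 3 * (X * rb + Y * ib) * X)
          - (D₂ * (g * Y) + φ * (g * ib - g ^ 3 * (X * rb + Y * ib) * Y))
            * (g * ra - g ^ 3 * (X * ra + Y * ia) * X)
        + (g ^ 2 * (D₁ * (X * ib - Y * rb) - D₂ * (X * ia - Y * ra))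
          + 2 * φ * (g ^ 2 * (ra * ib - rb * ia) - (g ^ 2) ^ 2
            * ((X * ra + Y * ia) * (X * ib - Y * rb) - (X * rb + Y * ib) * (X * ia - Y * ra)))) := by
    ring
  rw [e, add_sub_assoc, add_sub_cancel_left, hg]
  field_simp
  ring

lemma phaseDeriv_grad_re (δ : ℝ) (x : Space) (k : Fin 3) :
    (phaseDeriv δ (s.ψ x) (s.grad x k)).re = invSqrt δ (s.ψ x) * (s.grad x k).re
      - invSqrt δ (s.ψ x) ^ 3 * s.halfGradDensity x k * (s.ψ x).re := by
  rw [phaseDeriv_apply, halfGradDensity_eq, Complex.inner]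
  simp only [Complex.sub_re, Complex.real_smul, Complex.mul_re, Complex.mul_im, Complex.conj_re,
    Complex.conj_im, Complex.ofReal_re, Complex.ofReal_im]
  ring

lemma phaseDeriv_grad_im (δ : ℝ) (x : Space) (k : Fin 3) :
    (phaseDeriv δ (s.ψ x) (s.grad x k)).im = invSqrt δ (s.ψ x) * (s.grad x k).im
      - invSqrt δ (s.ψ x) ^ 3 * s.halfGradDensity x k * (s.ψ x).im := by
  rw [phaseDeriv_apply, halfGradDensity_eq, Complex.inner]
  simp only [Complex.sub_im, Complex.real_smul, Complex.mul_re, Complex.mul_im, Complex.conj_re,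
    Complex.conj_im, Complex.ofReal_re, Complex.ofReal_im]
  ring

/-! ### The regularized phase of a state and the curl of `j/(δ + ρ)` -/

section Regularized

variable {δ : ℝ} (hδ : 0 < δ)
include hδ

lemma isWeakGradient_phase : IsWeakGradient (fun x => phase δ (s.ψ x))
    (fun x k => phaseDeriv δ (s.ψ x) (s.grad x k)) :=
  s.isWeakGradient.comp (hasFDerivAt_phase hδ) (continuous_phaseDeriv hδ) (norm_phaseDeriv_le' hδ)

/-- From `∇ψ = i(π - Aψ)`. The product `Aψ` need not be in `L²_loc`, but the phase derivative times
`|ψ|` is at most `2`, leaving only `A`. -/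
lemma norm_phaseDeriv_grad_le (x : Space) (k : Fin 3) :
    ‖phaseDeriv δ (s.ψ x) (s.grad x k)‖ ≤ 2 * (√δ)⁻¹ * ‖s.momentum x k‖ + 2 * ‖A x k‖ := by
  have h1 : ‖s.grad x k‖ ≤ ‖s.momentum x k‖ + ‖A x k‖ * ‖s.ψ x‖ := by
    have : s.grad x k = Complex.I * (s.momentum x k - (A x k : ℂ) * s.ψ x) := by
      rw [momentum, add_sub_cancel_right, ← mul_assoc]; simp
    rw [this, norm_mul, Complex.norm_I, one_mul]
    refine (norm_sub_le _ _).trans_eq ?_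
    rw [norm_mul, Complex.norm_real]
  have h2 := invSqrt_mul_norm_le hδ (s.ψ x)
  have h3 : ‖phaseDeriv δ (s.ψ x)‖ * ‖s.ψ x‖ ≤ 2 := by
    have := mul_le_mul_of_nonneg_right (norm_phaseDeriv_le hδ (s.ψ x)) (norm_nonneg (s.ψ x))
    linarith
  calc _ ≤ ‖phaseDeriv δ (s.ψ x)‖ * (‖s.momentum x k‖ + ‖A x k‖ * ‖s.ψ x‖) :=
        (ContinuousLinearMap.le_opNorm _ _).trans (by gcongr)
    _ = ‖phaseDeriv δ (s.ψ x)‖ * ‖s.momentum x k‖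
        + (‖phaseDeriv δ (s.ψ x)‖ * ‖s.ψ x‖) * ‖A x k‖ := by ring
    _ ≤ _ := by gcongr; exact norm_phaseDeriv_le' hδ _

lemma locMemLp_phaseDeriv_grad (hA : ∀ k, LocMemLp 2 (fun x => A x k)) (k : Fin 3) :
    LocMemLp 2 (fun x => phaseDeriv δ (s.ψ x) (s.grad x k)) := by
  intro K hK
  refine MemLp.mono' (((s.memLp_momentum k).restrict K).norm.const_mul (2 * (√δ)⁻¹)
    |>.add ((hA k K hK).norm.const_mul 2)) ?_ (ae_of_all _ fun x => ?_)
  · exact ((s.isWeakGradient_phase hδ).locallyIntegrable_grad k).aestronglyMeasurable.restrict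
  · exact s.norm_phaseDeriv_grad_le hδ x k

lemma normSq_phase (x : Space) : ‖phase δ (s.ψ x)‖ ^ 2 = s.density x / (δ + s.density x) := by
  rw [phase, norm_smul, mul_pow, Real.norm_eq_abs, sq_abs, invSqrt_sq hδ, density, div_eq_inv_mul]

lemma inner_phase_phaseDeriv (x : Space) (k : Fin 3) :
    inner ℝ (phase δ (s.ψ x)) (phaseDeriv δ (s.ψ x) (s.grad x k))
      = δ / (δ + s.density x) ^ 2 * s.halfGradDensity x k := by
  have hd : 0 < δ + s.density x := add_norm_sq_pos hδ (s.ψ x)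
  have hg : invSqrt δ (s.ψ x) ^ 2 = (δ + s.density x)⁻¹ := invSqrt_sq hδ (s.ψ x)
  have h1 : inner ℝ (phase δ (s.ψ x)) (phaseDeriv δ (s.ψ x) (s.grad x k))
      = (invSqrt δ (s.ψ x) ^ 2 - (invSqrt δ (s.ψ x) ^ 2) ^ 2 * s.density x)
        * s.halfGradDensity x k := by
    rw [Complex.inner, Complex.mul_re, s.phaseDeriv_grad_re, s.phaseDeriv_grad_im]
    simp only [phase, density_eq, halfGradDensity_eq, Complex.conj_re, Complex.conj_im,
      Complex.real_smul, Complex.mul_re, Complex.mul_im, Complex.ofReal_re, Complex.ofReal_im]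
    ring
  rw [h1, hg]
  field_simp
  ring

/-- The chain rule `IsWeakGradient.comp` needs a bounded derivative, so it does not apply to `|ψ|²`;
it does apply to the squared modulus of the phase, which carries the same information as `ρ`. -/
lemma isWeakGradient_normSq_phase :
    IsWeakGradient (fun x => s.density x / (δ + s.density x))
      (fun x k => 2 * (δ / (δ + s.density x) ^ 2 * s.halfGradDensity x k)) := by
  have h := s.isWeakGradient.comp (Φ := fun z => ‖phase δ z‖ ^ 2)
    (Φ' := fun z => (2 • innerSL ℝ (phase δ z)).comp (phaseDeriv δ z)) (C := 2 * (2 * (√δ)⁻¹))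
    (fun z => (hasStrictFDerivAt_norm_sq _).hasFDerivAt.comp z (hasFDerivAt_phase hδ z))
    ((((innerSL ℝ).continuous.comp (continuous_phase hδ)).const_smul 2).clm_comp
      (continuous_phaseDeriv hδ)) (fun z => ?_)
  · convert h using 3 with x x k
    · exact (s.normSq_phase hδ x).symm
    · simp [← s.inner_phase_phaseDeriv hδ]
      ring
  · refine (ContinuousLinearMap.opNorm_comp_le _ _).trans
      (mul_le_mul ?_ (norm_phaseDeriv_le' hδ z) (norm_nonneg _) zero_le_two)
    refine (norm_nsmul_le).trans ?_
    rw [innerSL_apply_norm]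
    have := norm_phase_le hδ z
    simp; linarith

/-- The weak curl of the regularized velocity field `j / (δ + ρ)`. -/
theorem integral_curl_regularized {B : Space → Space} (hA : IsVectorPotential A B)
    (hψ : ∀ᵐ x, s.density x ≠ 0) {φ : Space → ℝ} (hφ : IsTestFunction univ φ) (k : Fin 3) :
    ∫ x, φ x * (s.density x / (δ + s.density x) * B x k) =
      -∫ x, ((pderiv (k + 1) φ x * s.totalCurrent x (k + 2)
          - pderiv (k + 2) φ x * s.totalCurrent x (k + 1)) / (δ + s.density x)
        + φ x * (2 * (δ / (δ + s.density x) ^ 2)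
          * ((s.halfGradDensity x (k + 1) * s.totalCurrent x (k + 2)
            - s.halfGradDensity x (k + 2) * s.totalCurrent x (k + 1)) / s.density x))) := by
  have hAL := hA.locMemLp
  have hu := s.isWeakGradient_phase hδ
  have hdu := s.locMemLp_phaseDeriv_grad hδ hAL
  have hp := hu.comp (Φ := Complex.re) (Φ' := fun _ => Complex.reCLM) (C := ‖Complex.reCLM‖)
    (fun z => Complex.reCLM.hasFDerivAt) continuous_const (fun _ => le_rfl)
  have hq := hu.comp (Φ := Complex.im) (Φ' := fun _ => Complex.imCLM) (C := ‖Complex.imCLM‖)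
    (fun z => Complex.imCLM.hasFDerivAt) continuous_const (fun _ => le_rfl)
  have hm := s.isWeakGradient_normSq_phase hδ
  simp only [Complex.reCLM_apply, Complex.imCLM_apply] at hp hq
  have hdp (k) : LocMemLp 2 (fun x => (phaseDeriv δ (s.ψ x) (s.grad x k)).re) := fun K hK =>
    (hdu k K hK).re
  have hdq (k) : LocMemLp 2 (fun x => (phaseDeriv δ (s.ψ x) (s.grad x k)).im) := fun K hK =>
    (hdu k K hK).im
  have hdm (k) : LocMemLp 2
      (fun x => 2 * (δ / (δ + s.density x) ^ 2 * s.halfGradDensity x k)) := by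
    refine (hdu k).mono (hm.locallyIntegrable_grad k).aestronglyMeasurable (C := 2)
      (ae_of_all _ fun x => ?_)
    rw [← s.inner_phase_phaseDeriv hδ, norm_mul, Real.norm_ofNat]
    gcongr
    exact (norm_inner_le_norm _ _).trans (mul_le_of_le_one_left (norm_nonneg _)
      (norm_phase_le hδ _))
  obtain ⟨hi1, h1⟩ := integral_curl_mul hm (M := 1) (fun x => by
      rw [← s.normSq_phase hδ, norm_pow, norm_norm]
      exact pow_le_one₀ (norm_nonneg _) (norm_phase_le hδ _)) hdm
    (A := fun x k => A x k) (B := fun x k => B x k) hAL hA.locallyIntegrable_curl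
    hA.curl.integral_eq hφ k
  -- The same product rule is applied to `p∇q`, and then to `q∇p`, where the second factor is
  -- curl-free; both integrals vanish.
  obtain ⟨hi2, h2⟩ := integral_curl_mul hp (M := 1)
    (fun x => (Complex.abs_re_le_norm _).trans (norm_phase_le hδ _)) hdp
    (B := fun _ _ => 0) hdq (fun _ => locallyIntegrable_zero) (fun φ hφ k => by
      rw [hq.integral_curl_eq_zero hφ]; simp) hφ k
  obtain ⟨hi3, h3⟩ := integral_curl_mul hq (M := 1)
    (fun x => (Complex.abs_im_le_norm _).trans (norm_phase_le hδ _)) hdq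
    (B := fun _ _ => 0) hdp (fun _ => locallyIntegrable_zero) (fun φ hφ k => by
      rw [hp.integral_curl_eq_zero hφ]; simp) hφ k
  simp only [mul_zero, integral_zero, zero_eq_neg] at h2 h3
  have h4 := integral_sub (hi1.add hi2) hi3
  rw [integral_add' hi1 hi2, h2, h3, add_zero, sub_zero] at h4
  rw [h1, neg_inj, ← h4]
  refine integral_congr_ae ?_
  filter_upwards [hψ] with x hx
  have hd : δ + s.density x ≠ 0 := (add_norm_sq_pos hδ (s.ψ x)).ne'
  have hg : invSqrt δ (s.ψ x) ^ 2 = (δ + s.density x)⁻¹ := invSqrt_sq hδ (s.ψ x)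
  simp only [Pi.add_apply, s.phaseDeriv_grad_re, s.phaseDeriv_grad_im, phase,
    Complex.real_smul, Complex.re_ofReal_mul, Complex.im_ofReal_mul, totalCurrent_apply,
    halfGradDensity_eq]
  rw [density_eq] at hx hd hg ⊢
  exact regularized_curl_identity hx hd hg

end Regularized

end State

/-! ### Densities determine the magnetic field -/

namespace State

variable {A A₁ A₂ : Space → Space}

/-- Equal densities give equal `ρ/(1 + ρ)`, whose weak gradients `2σ/(1 + ρ)²` then agree by
uniqueness; the positive factor cancels. -/
lemma halfGradDensity_ae_eq (s₁ : State A₁) (s₂ : State A₂)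
    (h : ∀ᵐ x, s₁.density x = s₂.density x) (k : Fin 3) :
    ∀ᵐ x, s₁.halfGradDensity x k = s₂.halfGradDensity x k := by
  have h1 := s₁.isWeakGradient_normSq_phase one_pos
  have h2 := s₂.isWeakGradient_normSq_phase one_pos
  have h3 := ae_eq_of_integral_contDiff_smul_eq (h1.locallyIntegrable_grad k)
    (h2.locallyIntegrable_grad k) fun φ hφ hφc => by
      rw [h1.integral_eq φ ⟨hφ, hφc, subset_univ _⟩ k, h2.integral_eq φ ⟨hφ, hφc, subset_univ _⟩ k]
      congr 1
      refine integral_congr_ae ?_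
      filter_upwards [h] with x hx
      rw [hx]
  filter_upwards [h, h3] with x hx h3x
  have hd : 1 + s₂.density x ≠ 0 := (add_norm_sq_pos one_pos (s₂.ψ x)).ne'
  rw [hx] at h3x
  field_simp at h3x
  exact h3x

/-- A single value of the regularization parameter, `δ = 1`, suffices: the error term is itself a
function of `ρ`, `j`, `σ`, so no limit is needed, nor any lower bound on `ρ`. -/
theorem curl_ae_eq {B₁ B₂ : Space → Space} (hA₁ : IsVectorPotential A₁ B₁)
    (hA₂ : IsVectorPotential A₂ B₂) (s₁ : State A₁) (s₂ : State A₂)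
    (h0 : ∀ᵐ x, s₁.density x ≠ 0) (hρ : ∀ᵐ x, s₁.density x = s₂.density x)
    (hj : ∀ᵐ x, s₁.totalCurrent x = s₂.totalCurrent x) : ∀ᵐ x, B₁ x = B₂ x := by
  have hσ := ae_all_iff.2 (halfGradDensity_ae_eq s₁ s₂ hρ)
  have h0' : ∀ᵐ x, s₂.density x ≠ 0 := by
    filter_upwards [h0, hρ] with x hx hx'
    rwa [← hx']
  have hloc {A B : Space → Space} (hA : IsVectorPotential A B) (s : State A) (k : Fin 3) :
      LocallyIntegrable fun x => s.density x / (1 + s.density x) * B x k := by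
    refine locallyIntegrable_of_norm_le (hA.locallyIntegrable_curl k) (C := 1)
      ((s.isWeakGradient_normSq_phase one_pos).locallyIntegrable.aestronglyMeasurable.mul
        (hA.locallyIntegrable_curl k).aestronglyMeasurable) (ae_of_all _ fun x => ?_)
    rw [norm_mul]
    gcongr
    rw [← s.normSq_phase one_pos, norm_pow, norm_norm]
    exact pow_le_one₀ (norm_nonneg _) (norm_phase_le one_pos _)
  have key (k : Fin 3) : ∀ᵐ x, s₁.density x / (1 + s₁.density x) * B₁ x k
      = s₂.density x / (1 + s₂.density x) * B₂ x k := by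
    refine ae_eq_of_integral_contDiff_smul_eq (hloc hA₁ s₁ k) (hloc hA₂ s₂ k)
      fun φ hφ hφc => ?_
    have hT : IsTestFunction univ φ := ⟨hφ, hφc, subset_univ _⟩
    simp only [smul_eq_mul]
    rw [s₁.integral_curl_regularized one_pos hA₁ h0 hT k,
      s₂.integral_curl_regularized one_pos hA₂ h0' hT k]
    congr 1
    refine integral_congr_ae ?_
    filter_upwards [hρ, hj, hσ] with x h1 h2 h3
    rw [h1, h2, h3, h3]
  filter_upwards [ae_all_iff.2 key, hρ, h0] with x hk h1 h2
  ext k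
  have h3 := hk k
  rw [← h1] at h3
  exact mul_left_cancel₀ (div_ne_zero h2 (add_norm_sq_pos one_pos (s₁.ψ x)).ne') h3

/-! ### The limit `δ → 0`: vorticity of `j/ρ` -/

section Vorticity

variable {B : Space → Space} (s : State A)

lemma density_nonneg (x : Space) : 0 ≤ s.density x := sq_nonneg _

lemma abs_totalCurrent_le (x : Space) (k : Fin 3) :
    |s.totalCurrent x k| ≤ √(s.density x) * ‖s.momentum x k‖ := by
  rw [← Real.sqrt_sq (norm_nonneg (s.momentum x k)), ← Real.sqrt_mul (s.density_nonneg x)]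
  exact Real.abs_le_sqrt (by rw [← s.sq_add_sq_eq]; linarith [sq_nonneg (s.halfGradDensity x k)])

lemma abs_halfGradDensity_le (x : Space) (k : Fin 3) :
    |s.halfGradDensity x k| ≤ √(s.density x) * ‖s.momentum x k‖ := by
  rw [← Real.sqrt_sq (norm_nonneg (s.momentum x k)), ← Real.sqrt_mul (s.density_nonneg x)]
  exact Real.abs_le_sqrt (by rw [← s.sq_add_sq_eq]; linarith [sq_nonneg (s.totalCurrent x k)])

lemma abs_inv_density_mul_totalCurrent_le {c : ℝ} (hc : 0 < c) {x : Space}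
    (hx : c ≤ s.density x) (k : Fin 3) :
    |(s.density x)⁻¹ * s.totalCurrent x k| ≤ (√c)⁻¹ * ‖s.momentum x k‖ := by
  have hpos := hc.trans_le hx
  have hs := Real.sqrt_pos.2 hpos
  rw [abs_mul, abs_of_pos (inv_pos.2 hpos)]
  calc _ ≤ (s.density x)⁻¹ * (√(s.density x) * ‖s.momentum x k‖) :=
        mul_le_mul_of_nonneg_left (s.abs_totalCurrent_le x k) (inv_pos.2 hpos).le
    _ = (√(s.density x))⁻¹ * ‖s.momentum x k‖ := by
        nth_rw 1 [← Real.sq_sqrt hpos.le]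
        field_simp
    _ ≤ _ := by
        gcongr

/-- Both `|j|` and `|σ|` are at most `√ρ |π|` componentwise, so the division by `ρ` costs nothing
and the error term is dominated by products of components of `π`, which are integrable. -/
lemma abs_cross_div_density_le (x : Space) (a b : Fin 3) :
    |(s.halfGradDensity x a * s.totalCurrent x b - s.halfGradDensity x b * s.totalCurrent x a)
      / s.density x| ≤ 2 * (‖s.momentum x a‖ * ‖s.momentum x b‖) := by
  rw [abs_div, abs_of_nonneg (s.density_nonneg x)]
  refine div_le_of_le_mul₀ (s.density_nonneg x) (by positivity) ?_
  have h (a b : Fin 3) : |s.halfGradDensity x a * s.totalCurrent x b|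
      ≤ ‖s.momentum x a‖ * ‖s.momentum x b‖ * s.density x := by
    rw [abs_mul]
    refine (mul_le_mul (s.abs_halfGradDensity_le x a) (s.abs_totalCurrent_le x b) (abs_nonneg _)
      (by positivity)).trans_eq ?_
    nth_rw 3 [← Real.sq_sqrt (s.density_nonneg x)]
    ring
  refine (abs_sub _ _).trans ?_
  linarith [h a b, h b a]

theorem isWeakCurlOn_velocity (hA : IsVectorPotential A B) (h0 : ∀ᵐ x, s.density x ≠ 0)
    {U : Set Space} (hU : IsOpen U)
    (hK : ∀ K : Set Space, IsCompact K → K ⊆ U →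
      ∃ c : ℝ, 0 < c ∧ ∀ᵐ x, x ∈ K → c ≤ s.density x) :
    IsWeakCurlOn U (fun x => (s.density x)⁻¹ • s.totalCurrent x) B where
  locallyIntegrableOn := by
    refine (locallyIntegrableOn_iff hU.isLocallyClosed).2 fun K hKU hKc => ?_
    obtain ⟨c, hc, h⟩ := hK K hKc hKU
    have : IsFiniteMeasure (volume.restrict K) := ⟨by simpa using hKc.measure_lt_top⟩
    refine integrable_piLp_iff.2 fun k => ?_
    refine Integrable.mono' ((((s.memLp_momentum k).restrict K).integrable one_le_two).norm.const_mul
      (√c)⁻¹) ?_ ?_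
    · exact (s.aestronglyMeasurable_density.inv₀.mul
        (s.aestronglyMeasurable_totalCurrent hA.locMemLp k)).restrict
    · refine (ae_restrict_iff' hKc.measurableSet).2 ?_
      filter_upwards [h] with x hx hxK
      exact s.abs_inv_density_mul_totalCurrent_le hc (hx hxK) k
  locallyIntegrableOn_curl := hA.curl.locallyIntegrableOn_curl.mono_set (subset_univ _)
  integral_eq φ hφ k := by
    obtain ⟨c, hc, hcK⟩ := hK _ hφ.compact hφ.subset
    have hφ' := hφ.mono (subset_univ U)
    have hjm := s.aestronglyMeasurable_totalCurrent hA.locMemLp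
    have hρm := s.aestronglyMeasurable_density
    have hlim : Tendsto (fun n : ℕ => 1 / ((n : ℝ) + 1)) atTop (𝓝 0) :=
      tendsto_one_div_add_atTop_nhds_zero_nat
    have hpos (n : ℕ) : 0 < 1 / ((n : ℝ) + 1) := by positivity
    have hden (x : Space) (hx : s.density x ≠ 0) :
        Tendsto (fun n : ℕ => 1 / ((n : ℝ) + 1) + s.density x) atTop (𝓝 (s.density x)) := by
      simpa using hlim.add_const (s.density x)
    have hleft : Tendsto (fun n : ℕ => ∫ x, φ x * (s.density x / (1 / ((n : ℝ) + 1) + s.density x)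
        * B x k)) atTop (𝓝 (∫ x, φ x * B x k)) := by
      refine tendsto_integral_of_dominated_convergence (fun x => ‖φ x * B x k‖) (fun n => ?_)
        (hφ'.integrable_smul (hA.locallyIntegrable_curl k)).norm (fun n => ae_of_all _ fun x => ?_) ?_
      · exact hφ.continuous.aestronglyMeasurable.mul
          ((hρm.div₀ (aestronglyMeasurable_const.add hρm)).mul
            (hA.locallyIntegrable_curl k).aestronglyMeasurable)
      · rw [norm_mul, norm_mul, norm_mul, ← s.normSq_phase (hpos n), norm_pow, norm_norm]
        gcongr
        exact mul_le_of_le_one_left (norm_nonneg _)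
          (pow_le_one₀ (norm_nonneg _) (norm_phase_le (hpos n) _))
      · filter_upwards [h0] with x hx
        have := (((tendsto_const_nhds (x := s.density x)).div (hden x hx) hx).mul_const (B x k)).const_mul (φ x)
        simpa [div_self hx] using this
    have hint (i l : Fin 3) : Integrable fun x =>
        |pderiv i φ x| * |(s.density x)⁻¹ * s.totalCurrent x l| := by
      obtain ⟨C, hC0, hC⟩ := (hφ.pderiv i).exists_norm_le
      refine integrable_of_norm_le_of_eq_zero (b := fun x => s.momentum x l) (C := C * (√c)⁻¹)
        ((s.memLp_momentum l).locallyIntegrable one_le_two) hφ.compact ?_ ?_ fun x hx => ?_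
      · exact (hφ.pderiv i).continuous.abs.aestronglyMeasurable.mul
          (hρm.inv₀.mul (hjm l)).norm
      · filter_upwards [hcK] with x hx hxK
        rw [norm_mul, Real.norm_eq_abs, Real.norm_eq_abs, abs_abs, abs_abs, mul_assoc]
        exact mul_le_mul (hC x) (s.abs_inv_density_mul_totalCurrent_le hc (hx hxK) l)
          (abs_nonneg _) hC0
      · rw [pderiv_eq_zero i hx, abs_zero, zero_mul]
    -- The constant `4/c` is `2` from `abs_cross_div_density_le` times the bound `2δ/(δ + ρ)² ≤ 2/(δ
    -- + ρ) ≤ 2/c`.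
    have hint2 : Integrable fun x => |φ x| * (4 / c *
        (‖s.momentum x (k + 1)‖ * ‖s.momentum x (k + 2)‖)) := by
      obtain ⟨C, hC0, hC⟩ := hφ.exists_norm_le
      have h1 : Integrable fun x => 4 / c * (‖s.momentum x (k + 1)‖ * ‖s.momentum x (k + 2)‖) :=
        ((s.memLp_momentum (k + 1)).norm.integrable_mul (s.memLp_momentum (k + 2)).norm).const_mul _
      exact h1.bdd_mul hφ.continuous.abs.aestronglyMeasurable
        (ae_of_all _ fun x => by simpa using hC x)
    have hright : Tendsto (fun n : ℕ => ∫ x,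
        ((pderiv (k + 1) φ x * s.totalCurrent x (k + 2)
          - pderiv (k + 2) φ x * s.totalCurrent x (k + 1)) / (1 / ((n : ℝ) + 1) + s.density x)
        + φ x * (2 * (1 / ((n : ℝ) + 1) / (1 / ((n : ℝ) + 1) + s.density x) ^ 2)
          * ((s.halfGradDensity x (k + 1) * s.totalCurrent x (k + 2)
            - s.halfGradDensity x (k + 2) * s.totalCurrent x (k + 1)) / s.density x)))) atTop
        (𝓝 (∫ x, (pderiv (k + 1) φ x * ((s.density x)⁻¹ • s.totalCurrent x) (k + 2)
          - pderiv (k + 2) φ x * ((s.density x)⁻¹ • s.totalCurrent x) (k + 1)))) := by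
      refine tendsto_integral_of_dominated_convergence _ (fun n => ?_)
        (((hint (k + 1) (k + 2)).add (hint (k + 2) (k + 1))).add hint2) (fun n => ?_) ?_
      · have hdm := (aestronglyMeasurable_const (b := 1 / ((n : ℝ) + 1))).add hρm
        have hσm := s.aestronglyMeasurable_halfGradDensity
        exact ((((hφ.pderiv _).continuous.aestronglyMeasurable.mul (hjm _)).sub
          ((hφ.pderiv _).continuous.aestronglyMeasurable.mul (hjm _))).div₀ hdm).add
          (hφ.continuous.aestronglyMeasurable.mul
          (((aestronglyMeasurable_const.div₀ (hdm.pow 2)).const_mul 2).mul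
            ((((hσm _).mul (hjm _)).sub ((hσm _).mul (hjm _))).div₀ hρm)))
      · filter_upwards [hcK] with x hx
        by_cases hxK : x ∈ tsupport φ
        · have hcx := hx hxK
          have hρ := hc.trans_le hcx
          have hn := hpos n
          set ε := 1 / ((n : ℝ) + 1)
          refine (norm_add_le _ _).trans (add_le_add ?_ ?_)
          · rw [norm_div, Real.norm_of_nonneg (r := ε + s.density x) (by positivity)]
            calc _ ≤ ‖pderiv (k + 1) φ x * s.totalCurrent x (k + 2)
                  - pderiv (k + 2) φ x * s.totalCurrent x (k + 1)‖ / s.density x := by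
                    gcongr; linarith
              _ ≤ (|pderiv (k + 1) φ x * s.totalCurrent x (k + 2)|
                  + |pderiv (k + 2) φ x * s.totalCurrent x (k + 1)|) / s.density x := by
                    gcongr; exact norm_sub_le _ _
              _ = _ := by
                    simp only [Pi.add_apply, abs_mul, abs_inv, abs_of_pos hρ]; field_simp
          · rw [norm_mul, norm_mul, Real.norm_eq_abs, Real.norm_eq_abs, Real.norm_eq_abs]
            refine mul_le_mul_of_nonneg_left ?_ (abs_nonneg _)
            have h1 : |2 * (ε / (ε + s.density x) ^ 2)| ≤ 2 / c := by
              rw [abs_of_nonneg (by positivity), mul_div_assoc', div_le_div_iff₀ (by positivity) hc]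
              nlinarith [mul_pos hn hρ, mul_nonneg hn.le (sub_nonneg.2 hcx), sq_nonneg ε,
                sq_nonneg (s.density x)]
            refine (mul_le_mul h1 (s.abs_cross_div_density_le x (k + 1) (k + 2)) (abs_nonneg _)
              (by positivity)).trans_eq (by ring)
        · rw [pderiv_eq_zero _ hxK, pderiv_eq_zero _ hxK, image_eq_zero_of_notMem_tsupport hxK]
          simp
          positivity
      · filter_upwards [h0] with x hx
        have h1 := (tendsto_const_nhds (x := pderiv (k + 1) φ x * s.totalCurrent x (k + 2)
          - pderiv (k + 2) φ x * s.totalCurrent x (k + 1))).div (hden x hx) hx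
        have h2 := (((hlim.div ((hden x hx).pow 2) (pow_ne_zero 2 hx)).const_mul 2).mul_const
          ((s.halfGradDensity x (k + 1) * s.totalCurrent x (k + 2)
            - s.halfGradDensity x (k + 2) * s.totalCurrent x (k + 1)) / s.density x)).const_mul (φ x)
        convert h1.add h2 using 2
        · rfl
        · rw [PiLp.smul_apply, PiLp.smul_apply, smul_eq_mul, smul_eq_mul, zero_div]
          ring
    refine tendsto_nhds_unique hleft (hright.neg.congr fun n => ?_)
    exact (s.integral_curl_regularized (hpos n) hA h0 hφ' k).symm

end Vorticity

end State

/-! ### Densities determine the scalar potential -/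

/-- The pairing `(z, w) ↦ z* w`. -/
def conjMul : ℂ →L[ℝ] ℂ →L[ℝ] ℂ :=
  (ContinuousLinearMap.mul ℝ ℂ).comp (Complex.conjCLE : ℂ →L[ℝ] ℂ)

lemma conjMul_apply (z w : ℂ) : conjMul z w = conj z * w := rfl

lemma norm_conjMul (z w : ℂ) : ‖conjMul z w‖ = ‖z‖ * ‖w‖ := by
  rw [conjMul_apply, norm_mul, RCLike.norm_conj]

lemma IsTestFunction.integrable_conjMul {U : Set Space} {φ : Space → ℂ} (hφ : IsTestFunction U φ)
    {b : Space → ℂ} (hb : LocallyIntegrable b) : Integrable fun x => conjMul (φ x) (b x) :=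
  hb.integrable_smul_left_of_hasCompactSupport (g := fun x => conj (φ x))
    (Complex.continuous_conj.comp hφ.continuous) (hφ.compact.comp_left (map_zero _))

lemma IsSobolevTest.integrable_conjMul {R M : ℝ} {f : Space → ℂ} {G : Space → Fin 3 → ℂ}
    (h : IsSobolevTest R M f G) {b : Space → ℂ} (hb : LocallyIntegrable b) :
    Integrable fun x => conjMul (f x) (b x) := by
  refine integrable_of_norm_le_of_eq_zero hb (isCompact_closedBall (0 : Space) R) (C := M)
    (conjMul.aestronglyMeasurable_comp₂ h.isWeakGradient.locallyIntegrable.aestronglyMeasurable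
      hb.aestronglyMeasurable) (ae_of_all _ fun x _ => ?_) fun x hx => ?_
  · rw [norm_conjMul]
    gcongr
    exact h.norm_le x
  · rw [h.eq_zero x (by simpa using hx)]
    simp

lemma IsSobolevTest.integrable_conjMul_grad {R M : ℝ} {f : Space → ℂ} {G : Space → Fin 3 → ℂ}
    (h : IsSobolevTest R M f G) {a : Space → ℂ} (ha : LocMemLp 2 a) (k : Fin 3) :
    Integrable fun x => conjMul (G x k) (a x) := by
  have hK := isCompact_closedBall (0 : Space) R
  have h1 : MemLp (fun x => conj (G x k)) 2
      (volume.restrict (Metric.closedBall (0 : Space) R)) := (h.locMemLp k _ hK).star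
  refine (integrableOn_iff_integrable_of_support_subset (s := Metric.closedBall (0 : Space) R)
    fun x hx => ?_).1 (h1.integrable_mul (ha _ hK))
  by_contra hxK
  exact hx (by simp [h.grad_eq_zero x (by simpa using hxK) k])

/-! ### The eigenvalue equation tested with the regularized phase -/

namespace State

variable {A A₁ A₂ : Space → Space} (s : State A) {v : Space → ℝ} {E : ℝ}

lemma locMemLp_momentum (k : Fin 3) : LocMemLp 2 (fun x => s.momentum x k) :=
  fun _ _ => (s.memLp_momentum k).restrict _

lemma locMemLp_I_mul_momentum (k : Fin 3) :
    LocMemLp 2 (fun x => Complex.I * s.momentum x k) :=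
  fun K hK => (s.locMemLp_momentum k K hK).const_mul _

lemma locallyIntegrable_mul_momentum (hA : ∀ k, LocMemLp 2 (fun x => A x k)) (k : Fin 3) :
    LocallyIntegrable (fun x => (A x k : ℂ) * s.momentum x k) :=
  locallyIntegrable_iff.2 fun K hK =>
    MemLp.integrable_mul (p := 2) (q := 2) ((hA k K hK).ofReal (K := ℂ))
      (s.locMemLp_momentum k K hK)

/-- The eigenvalue equation extends to bounded test functions with square-integrable weak
gradient. -/
lemma IsEigenstate.integral_eq_of_isSobolevTest {s : State A} (h : s.IsEigenstate v E)
    (hA : ∀ k, LocMemLp 2 (fun x => A x k)) {R M : ℝ} {f : Space → ℂ} {G : Space → Fin 3 → ℂ}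
    (hf : IsSobolevTest R M f G) :
    (1 / 2 : ℂ) * (∑ k, ∫ x, (conjMul (G x k) (Complex.I * s.momentum x k)
        + conjMul (f x) ((A x k : ℂ) * s.momentum x k)))
      + ∫ x, conjMul (f x) ((v x : ℂ) * s.ψ x) = (E : ℂ) * ∫ x, conjMul (f x) (s.ψ x) := by
  have hAm := s.locallyIntegrable_mul_momentum hA
  have hψ := s.isWeakGradient.locallyIntegrable
  have hlim1 := tendsto_finsetSum Finset.univ fun k (_ : k ∈ Finset.univ) =>
    (hf.tendsto_integral_pderiv conjMul (s.locMemLp_I_mul_momentum k) k).add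
    (hf.tendsto_integral conjMul (hAm k))
  have hlim := (hlim1.const_mul (1 / 2 : ℂ)).add (hf.tendsto_integral conjMul h.locallyIntegrable)
  have hrhs := (hf.tendsto_integral conjMul hψ).const_mul (E : ℂ)
  simp_rw [integral_add (hf.integrable_conjMul_grad (s.locMemLp_I_mul_momentum _) _)
    (hf.integrable_conjMul (hAm _))]
  refine tendsto_nhds_unique (hlim.congr fun n => ?_) hrhs
  have ht := hf.isTestFunction_mollify n
  have hi (k : Fin 3) := (ht.pderiv k).integrable_conjMul
    (s.locMemLp_I_mul_momentum k).locallyIntegrable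
  have hi' (k : Fin 3) := ht.integrable_conjMul (hAm k)
  refine Eq.trans ?_ (h.integral_eq _ ht)
  simp only [← integral_add (hi _) (hi' _)]
  have hi'' (k : Fin 3) : Integrable fun x => conjMul (pderiv k (mollify n f) x)
      (Complex.I * s.momentum x k) + conjMul (mollify n f x) ((A x k : ℂ) * s.momentum x k) :=
    (hi k).add (hi' k)
  rw [← integral_finsetSum _ fun k _ => hi'' k]
  refine congrArg₂ (· + ·) (congrArg _ (integral_congr_ae (ae_of_all _ fun x =>
    Finset.sum_congr rfl fun k _ => ?_))) rfl
  simp only [conjMul_apply, map_add, map_mul, map_neg, Complex.conj_I, Complex.conj_ofReal,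
    momentum]
  ring

/-- By `sq_add_sq_eq` the quadratic term is `|π|²`. The derivative falling on the real weight `η (1
+ ρ)^{-1/2}` multiplies `ψ* π = j - iσ` by `i`, so its real part sees only `σ`. -/
lemma re_conjMul_momentum {η dη : ℝ} {x : Space} (hx : s.density x ≠ 0) (k : Fin 3) :
    (conjMul (dη • phase 1 (s.ψ x) + η • phaseDeriv 1 (s.ψ x) (s.grad x k))
        (Complex.I * s.momentum x k)
      + conjMul (η • phase 1 (s.ψ x)) ((A x k : ℂ) * s.momentum x k)).re
    = η * (√(1 + s.density x))⁻¹ * ((s.totalCurrent x k ^ 2 + s.halfGradDensity x k ^ 2)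
        / s.density x)
      + s.halfGradDensity x k * ((√(1 + s.density x))⁻¹ * dη
        - η * (√(1 + s.density x))⁻¹ ^ 3 * s.halfGradDensity x k) := by
  have hg : (√(1 + s.density x))⁻¹ = invSqrt 1 (s.ψ x) := rfl
  rw [sq_add_sq_eq, mul_div_cancel_left₀ _ hx, Complex.sq_norm, Complex.normSq_apply,
    halfGradDensity_eq, hg]
  simp only [conjMul_apply, phaseDeriv_apply, phase, momentum, Complex.inner, Complex.add_re,
    Complex.add_im, Complex.sub_re, Complex.sub_im, Complex.mul_re, Complex.mul_im, Complex.neg_re,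
    Complex.neg_im, Complex.conj_re, Complex.conj_im, Complex.I_re, Complex.I_im,
    Complex.real_smul, Complex.ofReal_re, Complex.ofReal_im]
  ring

/-- The scalar potential in terms of the density and the current. -/
lemma IsEigenstate.integral_potential {s : State A} (h : s.IsEigenstate v E)
    (hA : ∀ k, LocMemLp 2 (fun x => A x k)) (h0 : ∀ᵐ x, s.density x ≠ 0) :
    LocallyIntegrable (fun x => (√(1 + s.density x))⁻¹ * s.density x * (v x - E)) ∧
    ∀ η : Space → ℝ, IsTestFunction univ η →
      ∫ x, η x * ((√(1 + s.density x))⁻¹ * s.density x * (v x - E)) =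
      -(1 / 2 * ∑ k, ∫ x,
        (η x * (√(1 + s.density x))⁻¹ * ((s.totalCurrent x k ^ 2 + s.halfGradDensity x k ^ 2)
          / s.density x)
        + s.halfGradDensity x k * ((√(1 + s.density x))⁻¹ * pderiv k η x
          - η x * (√(1 + s.density x))⁻¹ ^ 3 * s.halfGradDensity x k))) := by
  have hu := s.isWeakGradient_phase one_pos
  have hloc : LocallyIntegrable (fun x => (v x : ℂ) * s.ψ x - (E : ℂ) * s.ψ x) :=
    h.locallyIntegrable.sub (s.isWeakGradient.locallyIntegrable.smul (E : ℂ))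
  have hre (x : Space) : (conjMul (phase 1 (s.ψ x)) ((v x : ℂ) * s.ψ x - (E : ℂ) * s.ψ x)).re
      = (√(1 + s.density x))⁻¹ * s.density x * (v x - E) := by
    have hg : (√(1 + s.density x))⁻¹ = invSqrt 1 (s.ψ x) := rfl
    rw [hg, density_eq, conjMul_apply]
    simp [phase]
    ring
  constructor
  · have hm := (Complex.continuous_re.comp_aestronglyMeasurable
      (conjMul.aestronglyMeasurable_comp₂ hu.locallyIntegrable.aestronglyMeasurable
        hloc.aestronglyMeasurable))
    simp only [hre] at hm
    refine locallyIntegrable_of_norm_le hloc hm (C := 1) (ae_of_all _ fun x => ?_)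
    rw [← hre]
    refine (Complex.abs_re_le_norm _).trans ?_
    rw [norm_conjMul]
    gcongr
    exact norm_phase_le one_pos _
  · intro η hη
    -- The test function `η u` rather than `η ψ`: `u` is bounded, so the pairing with the merely
    -- locally integrable `vψ` makes sense.
    obtain ⟨R, M, hf⟩ := hu.isSobolevTest_smul (norm_phase_le one_pos <| s.ψ ·)
      (s.locMemLp_phaseDeriv_grad one_pos hA) hη
    have hψ := s.isWeakGradient.locallyIntegrable
    have key := h.integral_eq_of_isSobolevTest hA hf
    have hiv := hf.integrable_conjMul h.locallyIntegrable
    have hiE := hf.integrable_conjMul hψ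
    have hk (k : Fin 3) := (hf.integrable_conjMul_grad (s.locMemLp_I_mul_momentum k) k).add
      (hf.integrable_conjMul (s.locallyIntegrable_mul_momentum hA k))
    have e1 : ∫ x, conjMul (η x • phase 1 (s.ψ x)) ((v x : ℂ) * s.ψ x - (E : ℂ) * s.ψ x)
        = -(((1 / 2 : ℝ) : ℂ) * ∑ k, ∫ x, (conjMul (pderiv k η x • phase 1 (s.ψ x)
          + η x • phaseDeriv 1 (s.ψ x) (s.grad x k)) (Complex.I * s.momentum x k)
        + conjMul (η x • phase 1 (s.ψ x)) ((A x k : ℂ) * s.momentum x k))) := by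
      have e2 : ∫ x, conjMul (η x • phase 1 (s.ψ x)) ((v x : ℂ) * s.ψ x - (E : ℂ) * s.ψ x)
          = (∫ x, conjMul (η x • phase 1 (s.ψ x)) ((v x : ℂ) * s.ψ x))
            - (E : ℂ) * ∫ x, conjMul (η x • phase 1 (s.ψ x)) (s.ψ x) := by
        rw [← integral_const_mul, ← integral_sub hiv (hiE.const_mul _)]
        refine integral_congr_ae (ae_of_all _ fun x => ?_)
        simp only [conjMul_apply]
        ring
      rw [e2, ← key]
      push_cast
      ring
    have hiv' := hf.integrable_conjMul hloc
    have e3 := congrArg Complex.re e1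
    rw [Complex.neg_re, Complex.re_ofReal_mul, Complex.re_sum] at e3
    have hcomm {g : Space → ℂ} (hg : Integrable g) : (∫ x, g x).re = ∫ x, (g x).re := by
      have := Complex.reCLM.integral_comp_comm hg
      simp only [Complex.reCLM_apply] at this
      exact this.symm
    rw [hcomm hiv'] at e3
    have e4 (x : Space) : (conjMul (η x • phase 1 (s.ψ x))
        ((v x : ℂ) * s.ψ x - (E : ℂ) * s.ψ x)).re
        = η x * ((√(1 + s.density x))⁻¹ * s.density x * (v x - E)) := by
      rw [← hre, map_smul, smul_apply, Complex.smul_re, smul_eq_mul]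
    simp only [e4] at e3
    rw [e3]
    congr 2
    refine Finset.sum_congr rfl fun k _ => ?_
    refine (hcomm (hk k)).trans (integral_congr_ae ?_)
    filter_upwards [h0] with x hx
    exact s.re_conjMul_momentum hx k

/-- Both potentials satisfy the same formula in `ρ`, `j`, `σ`, so `v₁ - E₁ = v₂ - E₂` once the
nonvanishing factor `ρ/(1 + ρ)^{1/2}` is divided out. -/
theorem IsEigenstate.exists_const {v₁ v₂ : Space → ℝ} {E₁ E₂ : ℝ} {s₁ : State A₁} {s₂ : State A₂}
    (h₁ : s₁.IsEigenstate v₁ E₁) (h₂ : s₂.IsEigenstate v₂ E₂)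
    (hA₁ : ∀ k, LocMemLp 2 (fun x => A₁ x k)) (hA₂ : ∀ k, LocMemLp 2 (fun x => A₂ x k))
    (h0 : ∀ᵐ x, s₁.density x ≠ 0) (hρ : ∀ᵐ x, s₁.density x = s₂.density x)
    (hj : ∀ᵐ x, s₁.totalCurrent x = s₂.totalCurrent x) : ∃ c : ℝ, ∀ᵐ x, v₂ x = v₁ x + c := by
  have hσ := ae_all_iff.2 (halfGradDensity_ae_eq s₁ s₂ hρ)
  have h0' : ∀ᵐ x, s₂.density x ≠ 0 := by
    filter_upwards [h0, hρ] with x hx hx'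
    rwa [← hx']
  obtain ⟨hl₁, hi₁⟩ := h₁.integral_potential hA₁ h0
  obtain ⟨hl₂, hi₂⟩ := h₂.integral_potential hA₂ h0'
  refine ⟨E₂ - E₁, ?_⟩
  have key := ae_eq_of_integral_contDiff_smul_eq hl₁ hl₂ fun η hη hηc => by
    have hT : IsTestFunction univ η := ⟨hη, hηc, subset_univ _⟩
    simp only [smul_eq_mul]
    rw [hi₁ η hT, hi₂ η hT]
    congr 2
    refine Finset.sum_congr rfl fun k _ => integral_congr_ae ?_
    filter_upwards [hρ, hj, hσ] with x e1 e2 e3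
    rw [e1, e2, e3]
  filter_upwards [key, hρ, h0] with x hx e1 e2
  rw [← e1] at hx
  have hg : (√(1 + s₁.density x))⁻¹ ≠ 0 := (invSqrt_pos one_pos (s₁.ψ x)).ne'
  linarith [mul_left_cancel₀ (mul_ne_zero hg e2) hx]

end State

/-! ### Curl-free fields are gradients -/

section Averaging

variable {T : Type*} [MeasurableSpace T] {ν : Measure T} [IsFiniteMeasure ν] {τ : T → Space}
  {w : T → ℝ} {C : ℝ} {b : Space → ℝ}

lemma integrable_mul_translate (hτ : Measurable τ) (hw : Measurable w) (hC : ∀ᵐ z ∂ν, ‖w z‖ ≤ C)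
    (hb : StronglyMeasurable b) (hbi : Integrable b) :
    Integrable (fun p : Space × T => w p.2 * b (p.1 - τ p.2)) (volume.prod ν) := by
  have hm : AEStronglyMeasurable (fun p : Space × T => w p.2 * b (p.1 - τ p.2))
      (volume.prod ν) :=
    ((hw.comp measurable_snd).mul (hb.measurable.comp
      (measurable_fst.sub (hτ.comp measurable_snd)))).aestronglyMeasurable
  refine (integrable_prod_iff' hm).2
    ⟨ae_of_all _ fun z => (hbi.comp_sub_right (τ z)).const_mul (w z), ?_⟩
  simp only [norm_mul, integral_const_mul]
  have h (z : T) : ∫ x, ‖b (x - τ z)‖ = ∫ x, ‖b x‖ :=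
    integral_sub_right_eq_self (fun x => ‖b x‖) (τ z)
  simp only [h]
  refine Integrable.mul_const ?_ _
  exact Integrable.of_bound hw.norm.aestronglyMeasurable C (by simpa using hC)

lemma truncate_translate_eq {R : ℝ} {x t : Space} (hx : ‖x‖ ≤ R) (ht : ‖t‖ ≤ 1) :
    (Metric.closedBall (0 : Space) (R + 1)).indicator b (x - t) = b (x - t) :=
  indicator_of_mem (by simpa using (norm_sub_le x t).trans (by linarith)) b

lemma locallyIntegrable_integral_translate (hτ : Measurable τ) (hτ1 : ∀ᵐ z ∂ν, ‖τ z‖ ≤ 1)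
    (hw : Measurable w) (hC : ∀ᵐ z ∂ν, ‖w z‖ ≤ C) (hb : StronglyMeasurable b)
    (hbl : LocallyIntegrable b) : LocallyIntegrable fun x => ∫ z, w z * b (x - τ z) ∂ν := by
  refine locallyIntegrable_iff.2 fun K hK => ?_
  obtain ⟨R, -, hR⟩ := exists_norm_le_of_isCompact hK
  have h := (integrable_mul_translate hτ hw hC (hb.indicator measurableSet_closedBall)
    ((integrable_indicator_iff measurableSet_closedBall).2
      (locallyIntegrable_iff.1 hbl _ (isCompact_closedBall (0 : Space) (R + 1))))).integral_prod_left
  refine h.integrableOn.congr_fun (fun x hx => ?_) hK.measurableSet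
  refine integral_congr_ae ?_
  filter_upwards [hτ1] with z hz
  simp only [truncate_translate_eq (hR x hx) hz]

/-- Fubini and a change of variables move the averaged translation from `b` onto the test function.
Since `|τ| ≤ 1`, `b` may be cut off to a ball, which makes it integrable. -/
lemma integral_mul_integral_translate (hτ : Measurable τ) (hτ1 : ∀ᵐ z ∂ν, ‖τ z‖ ≤ 1)
    (hw : Measurable w) (hC : ∀ᵐ z ∂ν, ‖w z‖ ≤ C) (hb : StronglyMeasurable b)
    (hbl : LocallyIntegrable b) {η : Space → ℝ} (hη : IsTestFunction univ η) :
    Integrable (fun z => w z * ∫ x, η (x + τ z) * b x) ν ∧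
    ∫ x, η x * (∫ z, w z * b (x - τ z) ∂ν) = ∫ z, w z * (∫ x, η (x + τ z) * b x) ∂ν := by
  obtain ⟨R, -, hR⟩ := exists_norm_le_of_isCompact hη.compact
  obtain ⟨M, hM0, hM⟩ := hη.exists_norm_le
  have h := (integrable_mul_translate hτ hw hC (hb.indicator measurableSet_closedBall)
    ((integrable_indicator_iff measurableSet_closedBall).2
      (locallyIntegrable_iff.1 hbl _ (isCompact_closedBall (0 : Space) (R + 1)))))
  have hint : Integrable (fun p : Space × T => η p.1 * (w p.2 *
      (Metric.closedBall (0 : Space) (R + 1)).indicator b (p.1 - τ p.2))) (volume.prod ν) :=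
    h.bdd_mul (hη.continuous.measurable.comp measurable_fst).aestronglyMeasurable
      (ae_of_all _ fun p => hM p.1)
  have hoff {x : Space} (hx : ¬ ‖x‖ ≤ R) : η x = 0 :=
    image_eq_zero_of_notMem_tsupport fun h => hx (hR x h)
  have hinner (z : T) (hz : ‖τ z‖ ≤ 1) : ∫ x, η x * (w z *
      (Metric.closedBall (0 : Space) (R + 1)).indicator b (x - τ z))
      = w z * ∫ x, η (x + τ z) * b x := by
    rw [← integral_const_mul, ← integral_add_right_eq_self _ (τ z)]
    refine integral_congr_ae (ae_of_all _ fun x => ?_)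
    by_cases hx : ‖x + τ z‖ ≤ R
    · have h' := truncate_translate_eq (b := b) hx hz
      rw [add_sub_cancel_right] at h'
      simp only [add_sub_cancel_right, h']
      ring
    · simp only [hoff hx]
      ring
  constructor
  · refine hint.integral_prod_right.congr ?_
    filter_upwards [hτ1] with z hz using hinner z hz
  · calc _ = ∫ x, (∫ z, η x * (w z *
          (Metric.closedBall (0 : Space) (R + 1)).indicator b (x - τ z)) ∂ν) := by
          refine integral_congr_ae (ae_of_all _ fun x => ?_)
          dsimp only
          rw [← integral_const_mul]
          refine integral_congr_ae ?_
          filter_upwards [hτ1] with z hz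
          by_cases hx : ‖x‖ ≤ R
          · rw [truncate_translate_eq hx hz]
          · rw [hoff hx, zero_mul, zero_mul]
      _ = ∫ z, (∫ x, η x * (w z *
          (Metric.closedBall (0 : Space) (R + 1)).indicator b (x - τ z))) ∂ν :=
          integral_integral_swap hint
      _ = _ := by
          refine integral_congr_ae ?_
          filter_upwards [hτ1] with z hz using hinner z hz

end Averaging

/-! ### The Poincaré lemma: a smooth part plus a segment-average primitive -/

lemma fderiv_apply_eq_sum (η : Space → ℝ) (y t : Space) :
    fderiv ℝ η y t = ∑ k, t k * pderiv k η y := by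
  conv_lhs => rw [← (EuclideanSpace.basisFun (Fin 3) ℝ).sum_repr t]
  simp [pderiv]

lemma isTestFunction_translate {η : Space → ℝ} (hη : IsTestFunction univ η) (t : Space) :
    IsTestFunction univ fun x => η (x + t) where
  smooth := hη.smooth.comp (contDiff_id.add contDiff_const)
  compact := hη.compact.comp_homeomorph (Homeomorph.addRight t)
  subset := subset_univ _

lemma pderiv_translate (η : Space → ℝ) (t : Space) (k : Fin 3) (x : Space) :
    pderiv k (fun x => η (x + t)) x = pderiv k η (x + t) := by
  rw [pderiv, fderiv_comp_add_right]; rfl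

/-- The fundamental theorem of calculus along a translation, integrated against `b`. -/
lemma integral_sum_translate {η b : Space → ℝ} (hη : IsTestFunction univ η)
    (hb : LocallyIntegrable b) {t : Space} (ht : ‖t‖ ≤ 1) :
    ∫ s in Ioc (0 : ℝ) 1, ∑ k, t k * ∫ x, pderiv k η (x + s • t) * b x
      = (∫ x, η (x + t) * b x) - ∫ x, η x * b x := by
  obtain ⟨R, -, hR⟩ := exists_norm_le_of_isCompact hη.compact
  have hcont : Continuous (fderiv ℝ η) := hη.smooth.continuous_fderiv (by simp)
  obtain ⟨M, hM⟩ := (hη.compact.fderiv ℝ).exists_bound_of_continuous hcont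
  have hM0 : 0 ≤ M := (norm_nonneg _).trans (hM 0)
  have hint : Integrable (fun p : ℝ × Space => fderiv ℝ η (p.2 + p.1 • t) t * b p.2)
      ((volume.restrict (Ioc (0 : ℝ) 1)).prod volume) := by
    have hbt : Integrable ((Metric.closedBall (0 : Space) (R + 1)).indicator b) :=
      (integrable_indicator_iff measurableSet_closedBall).2
      (locallyIntegrable_iff.1 hb _ (isCompact_closedBall (0 : Space) (R + 1)))
    have h1 : Integrable (fun p : ℝ × Space => M * ‖(Metric.closedBall (0 : Space)
        (R + 1)).indicator b p.2‖) ((volume.restrict (Ioc (0 : ℝ) 1)).prod volume) :=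
      (hbt.norm.const_mul M).comp_snd _
    refine h1.mono' (Continuous.aestronglyMeasurable (by fun_prop) |>.mul
      hb.aestronglyMeasurable.comp_snd) ?_
    have hs : ∀ᵐ p ∂((volume.restrict (Ioc (0 : ℝ) 1)).prod (volume : Measure Space)),
        p.1 ∈ Ioc (0 : ℝ) 1 :=
      Measure.quasiMeasurePreserving_fst.ae (ae_restrict_mem measurableSet_Ioc)
    filter_upwards [hs] with p hp
    have hst : ‖p.1 • t‖ ≤ 1 := by
      rw [norm_smul, Real.norm_of_nonneg hp.1.le]
      exact mul_le_one₀ hp.2 (norm_nonneg _) ht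
    by_cases hx : p.2 ∈ Metric.closedBall (0 : Space) (R + 1)
    · rw [indicator_of_mem hx, norm_mul]
      gcongr
      exact ((fderiv ℝ η _).le_of_opNorm_le (hM _) t).trans (mul_le_of_le_one_right hM0 ht)
    · have : fderiv ℝ η (p.2 + p.1 • t) = 0 := by
        by_contra h
        have h1 := hR _ (support_fderiv_subset ℝ (f := η) h)
        have h2 : ‖p.2‖ ≤ ‖p.2 + p.1 • t‖ + ‖p.1 • t‖ := by
          simpa using norm_sub_le (p.2 + p.1 • t) (p.1 • t)
        exact hx (by simp; linarith)
      rw [this]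
      simp
      positivity
  calc _ = ∫ s in Ioc (0 : ℝ) 1, ∫ x, fderiv ℝ η (x + s • t) t * b x := by
        refine integral_congr_ae (ae_of_all _ fun s => ?_)
        have hi (k : Fin 3) : Integrable fun x => pderiv k η (x + s • t) * b x :=
          (isTestFunction_translate (hη.pderiv k) (s • t)).integrable_smul hb
        simp only [← integral_const_mul]
        rw [← integral_finsetSum _ fun k _ => (hi k).const_mul _]
        refine integral_congr_ae (ae_of_all _ fun x => ?_)
        simp only [fderiv_apply_eq_sum, Finset.sum_mul, mul_assoc]
    _ = ∫ x, ∫ s in Ioc (0 : ℝ) 1, fderiv ℝ η (x + s • t) t * b x :=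
        integral_integral_swap hint
    _ = ∫ x, (η (x + t) * b x - η x * b x) := by
        refine integral_congr_ae (ae_of_all _ fun x => ?_)
        dsimp only
        rw [integral_mul_const, ← sub_mul, ← intervalIntegral.integral_of_le zero_le_one]
        congr 1
        have hd (s : ℝ) : HasDerivAt (fun s : ℝ => η (x + s • t)) (fderiv ℝ η (x + s • t) t) s := by
          have h1 : HasDerivAt (fun s : ℝ => x + s • t) t s := by
            simpa using ((hasDerivAt_id s).smul_const t).const_add x
          exact (hη.smooth.differentiable (by simp) _).hasFDerivAt.comp_hasDerivAt s h1
        rw [intervalIntegral.integral_eq_sub_of_hasDerivAt (fun s _ => hd s)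
          (Continuous.intervalIntegrable (by fun_prop) _ _)]
        simp
    _ = _ := integral_sub ((isTestFunction_translate hη t).integrable_smul hb)
        (hη.integrable_smul hb)

/-- The mollified field is smooth with symmetric Jacobian, so the classical Poincaré lemma on the
convex set `ℝ³` applies. -/
lemma exists_isWeakGradient_mollify {a : Space → Fin 3 → ℝ}
    (ha : ∀ k, LocallyIntegrable (fun x => a x k))
    (hcurl : ∀ φ : Space → ℝ, IsTestFunction univ φ → ∀ i k,
      ∫ x, pderiv i φ x * a x k = ∫ x, pderiv k φ x * a x i) (n : ℕ) :
    ∃ f : Space → ℝ, IsWeakGradient f (fun x k => mollify n (fun y => a y k) x) := by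
  have hsm (k) := mollify_contDiff n (ha k)
  let form : Space → Space →L[ℝ] ℝ := fun x => ∑ k, mollify n (fun y => a y k) x •
    (EuclideanSpace.proj k : Space →L[ℝ] ℝ)
  have hform (x : Space) : HasFDerivAt form (∑ k, (fderiv ℝ (mollify n fun y => a y k) x).smulRight
      (EuclideanSpace.proj k : Space →L[ℝ] ℝ)) x :=
    HasFDerivAt.fun_sum fun k _ =>
      (((hsm k).differentiable (by simp) x).hasFDerivAt).smul_const
        (EuclideanSpace.proj k : Space →L[ℝ] ℝ)
  have hsymm (x : Space) (i k : Fin 3) : pderiv i (mollify n fun y => a y k) x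
      = pderiv k (mollify n fun y => a y i) x := by
    rw [pderiv_mollify n (ha k), pderiv_mollify n (ha i)]
    exact congrArg Neg.neg (hcurl _ (isTestFunction_kernel_sub n x) i k)
  obtain ⟨f, hf⟩ := (convex_univ (𝕜 := ℝ) (E := Space)).exists_forall_hasFDerivAt_of_fderiv_symmetric
    isOpen_univ (fun x _ => (hform x).differentiableAt.differentiableWithinAt)
    (fun x _ u v => by
      rw [(hform x).fderiv]
      simp only [sum_apply, ContinuousLinearMap.smulRight_apply,
        smul_apply, PiLp.proj_apply, smul_eq_mul, fderiv_apply_eq_sum, Finset.sum_mul]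
      rw [Finset.sum_comm]
      refine Finset.sum_congr rfl fun i _ => Finset.sum_congr rfl fun k _ => ?_
      rw [hsymm]
      ring)
  have hformc : Continuous form := continuous_finsetSum _ fun k _ =>
    (hsm k).continuous.smul continuous_const
  refine ⟨f, ?_⟩
  convert isWeakGradient_of_hasFDerivAt (fun x => hf x (mem_univ x)) hformc using 3 with x k
  simp [form]

lemma exists_norm_kernel_mul_le (n : ℕ) : ∃ C, ∀ t : Space, ‖t‖ ≤ 1 →
    ‖kernel n t‖ ≤ C ∧ ∀ k, ‖kernel n t * t k‖ ≤ C := by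
  obtain ⟨C, hC⟩ := (kernel_hasCompactSupport n).exists_bound_of_continuous (kernel_continuous n)
  refine ⟨C, fun t ht => ⟨hC t, fun k => ?_⟩⟩
  rw [norm_mul]
  exact (mul_le_of_le_one_right (norm_nonneg _) ((PiLp.norm_apply_le t k).trans ht)).trans (hC t)

lemma mollify_eq_setIntegral (n : ℕ) (f : Space → ℝ) (x : Space) :
    mollify n f x = ∫ t in Metric.closedBall 0 1, kernel n t * f (x - t) := by
  rw [mollify_apply, setIntegral_eq_integral_of_forall_compl_eq_zero]
  · rfl
  · intro t ht
    rw [kernel_eq_zero_of_one_le (not_le.1 (by simpa using ht)).le, zero_mul]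

/-- The measure on pairs `(t, s)` over which the translates by `s • t` are averaged. -/
def segmentMeasure : Measure (Space × ℝ) :=
  (volume.restrict (Metric.closedBall 0 1)).prod (volume.restrict (Ioc 0 1))

instance : IsFiniteMeasure (volume.restrict (Metric.closedBall (0 : Space) 1)) :=
  ⟨by simp⟩

instance : IsFiniteMeasure segmentMeasure := by
  unfold segmentMeasure; infer_instance

lemma ae_norm_le_one :
    ∀ᵐ t ∂(volume.restrict (Metric.closedBall (0 : Space) 1)), ‖t‖ ≤ 1 := by
  filter_upwards [ae_restrict_mem measurableSet_closedBall] with t ht using by simpa using ht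

lemma ae_segmentMeasure : ∀ᵐ z ∂segmentMeasure, ‖z.1‖ ≤ 1 ∧ ‖z.2 • z.1‖ ≤ 1 := by
  have h1 : ∀ᵐ z ∂segmentMeasure, ‖z.1‖ ≤ 1 :=
    Measure.quasiMeasurePreserving_fst.ae ae_norm_le_one
  have h2 : ∀ᵐ z ∂segmentMeasure, z.2 ∈ Ioc (0 : ℝ) 1 :=
    Measure.quasiMeasurePreserving_snd.ae (ae_restrict_mem measurableSet_Ioc)
  filter_upwards [h1, h2] with z hz hs
  refine ⟨hz, ?_⟩
  rw [norm_smul, Real.norm_of_nonneg hs.1.le]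
  exact mul_le_one₀ hs.2 (norm_nonneg _) hz

/-- A primitive of the difference between a curl-free field `a` and its mollification. -/
def segmentPotential (a : Space → Fin 3 → ℝ) (k : Fin 3) (x : Space) : ℝ :=
  ∫ z, kernel 0 z.1 * z.1 k * a (x - z.2 • z.1) k ∂segmentMeasure

lemma measurable_segment : Measurable fun z : Space × ℝ => z.2 • z.1 :=
  (Continuous.measurable (by fun_prop))

lemma measurable_kernel_mul (k : Fin 3) :
    Measurable fun z : Space × ℝ => kernel 0 z.1 * z.1 k :=
  (((kernel_continuous 0).comp continuous_fst).mul (by fun_prop)).measurable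

lemma segmentPotential_locallyIntegrable {a : Space → Fin 3 → ℝ} {k : Fin 3}
    (ha : LocallyIntegrable (fun x => a x k)) (hm : StronglyMeasurable fun x => a x k) :
    LocallyIntegrable (segmentPotential a k) := by
  obtain ⟨C, hC⟩ := exists_norm_kernel_mul_le 0
  exact locallyIntegrable_integral_translate measurable_segment
    (ae_segmentMeasure.mono fun z hz => hz.2) (measurable_kernel_mul k)
    (ae_segmentMeasure.mono fun z hz => (hC _ hz.1).2 k) hm ha

/-- The sum over `k` of `segmentPotential a k` is the average of `∫₀¹ t · a(x - s t) ds` against the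
kernel. It is the line integral of `a` from `x - t` to `x`, so its gradient is `a(x) - a(x - t)`
averaged over `t`, namely `a` minus its mollification. -/
lemma integral_pderiv_mul_segmentPotential {a : Space → Fin 3 → ℝ}
    (ha : ∀ k, LocallyIntegrable (fun x => a x k)) (hm : ∀ k, StronglyMeasurable fun x => a x k)
    (hcurl : ∀ φ : Space → ℝ, IsTestFunction univ φ → ∀ i k,
      ∫ x, pderiv i φ x * a x k = ∫ x, pderiv k φ x * a x i)
    {η : Space → ℝ} (hη : IsTestFunction univ η) (i : Fin 3) :
    ∑ k, ∫ x, pderiv i η x * segmentPotential a k x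
      = (∫ x, η x * mollify 0 (fun y => a y i) x) - ∫ x, η x * a x i := by
  obtain ⟨C, hC⟩ := exists_norm_kernel_mul_le 0
  have hswap (k l : Fin 3) (m : Fin 3) := integral_mul_integral_translate measurable_segment
    (ae_segmentMeasure.mono fun z hz => hz.2) (measurable_kernel_mul k)
    (ae_segmentMeasure.mono fun z hz => (hC _ hz.1).2 k) (hm l) (ha l) (hη.pderiv m)
  have hmoll := integral_mul_integral_translate (τ := fun t : Space => t) measurable_id
    ae_norm_le_one (kernel_continuous 0).measurable
    (ae_norm_le_one.mono fun t ht => (hC t ht).1) (hm i) (ha i) hη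
  have hone : ∫ t in Metric.closedBall (0 : Space) 1, kernel 0 t = 1 :=
    (setIntegral_eq_integral_of_forall_compl_eq_zero fun t ht =>
      kernel_eq_zero_of_one_le (not_le.1 (by simpa using ht)).le).trans (integral_kernel 0)
  have hki : IntegrableOn (kernel 0) (Metric.closedBall (0 : Space) 1) :=
    (kernel_integrable 0).integrableOn
  -- Curl-freeness trades `∂ᵢ` on `aₖ` for `∂ₖ` on `aᵢ`; the sum with `tₖ` then becomes a derivative
  -- along the segment, to which the fundamental theorem of calculus applies.
  have hcomm (z : Space × ℝ) (k : Fin 3) : ∫ x, pderiv i η (x + z.2 • z.1) * a x k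
      = ∫ x, pderiv k η (x + z.2 • z.1) * a x i := by
    simpa only [pderiv_translate] using
      hcurl _ (isTestFunction_translate hη (z.2 • z.1)) i k
  calc _ = ∑ k, ∫ z, kernel 0 z.1 * z.1 k *
        (∫ x, pderiv k η (x + z.2 • z.1) * a x i) ∂segmentMeasure := by
        refine Finset.sum_congr rfl fun k _ => ((hswap k k i).2).trans ?_
        simp only [hcomm]
    _ = ∫ z, ∑ k, kernel 0 z.1 * z.1 k *
        (∫ x, pderiv k η (x + z.2 • z.1) * a x i) ∂segmentMeasure :=
        (integral_finsetSum _ fun k _ => (hswap k i k).1).symm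
    _ = ∫ t in Metric.closedBall (0 : Space) 1, ∫ s in Ioc (0 : ℝ) 1,
          ∑ k, kernel 0 t * t k * (∫ x, pderiv k η (x + s • t) * a x i) :=
        integral_prod _ (integrable_finsetSum _ fun k _ => (hswap k i k).1)
    _ = ∫ t in Metric.closedBall (0 : Space) 1,
          (kernel 0 t * (∫ x, η (x + t) * a x i) - kernel 0 t * ∫ x, η x * a x i) := by
        refine integral_congr_ae (ae_norm_le_one.mono fun t ht => ?_)
        dsimp only
        rw [← mul_sub, ← integral_sum_translate hη (ha i) ht, ← integral_const_mul]
        simp only [Finset.mul_sum, mul_assoc]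
    _ = _ := by
        rw [integral_sub hmoll.1 (hki.mul_const _), ← hmoll.2, integral_mul_const, hone, one_mul]
        simp only [mollify_eq_setIntegral]

/-- Split `a` into its mollification, which has a smooth primitive, and the remainder, with its
explicit locally integrable primitive. One fixed scale suffices, so no limit of primitives is taken.
-/
lemma exists_isWeakGradient_of_stronglyMeasurable {a : Space → Fin 3 → ℝ}
    (ha : ∀ k, LocallyIntegrable (fun x => a x k)) (hm : ∀ k, StronglyMeasurable fun x => a x k)
    (hcurl : ∀ φ : Space → ℝ, IsTestFunction univ φ → ∀ i k,
      ∫ x, pderiv i φ x * a x k = ∫ x, pderiv k φ x * a x i) :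
    ∃ χ : Space → ℝ, IsWeakGradient χ a := by
  obtain ⟨f, hf⟩ := exists_isWeakGradient_mollify ha hcurl 0
  have hV (k) := segmentPotential_locallyIntegrable (ha k) (hm k)
  refine ⟨fun x => f x + ∑ k, segmentPotential a k x,
    hf.locallyIntegrable.add ?_, ha, fun η hη i => ?_⟩
  · simp only [Fin.sum_univ_three]
    exact ((hV 0).add (hV 1)).add (hV 2)
  have hVi (k) : Integrable fun x => pderiv i η x * segmentPotential a k x :=
    (hη.pderiv i).integrable_smul (hV k)
  have h1 := hf.integral_eq η hη i
  have h2 := integral_pderiv_mul_segmentPotential ha hm hcurl hη i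
  simp only [smul_eq_mul, mul_add, Finset.mul_sum] at h1 ⊢
  have h3 := integral_add ((hη.pderiv i).integrable_smul hf.locallyIntegrable)
    (integrable_finsetSum Finset.univ fun k _ => hVi k)
  rw [integral_finsetSum _ fun k _ => hVi k, h2] at h3
  simp only [smul_eq_mul] at h3
  rw [h3]
  linarith

/-- The Poincaré lemma for locally integrable fields. -/
theorem exists_isWeakGradient_of_curl_eq_zero {a : Space → Fin 3 → ℝ}
    (ha : ∀ k, LocallyIntegrable (fun x => a x k))
    (hcurl : ∀ φ : Space → ℝ, IsTestFunction univ φ → ∀ i k,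
      ∫ x, pderiv i φ x * a x k = ∫ x, pderiv k φ x * a x i) :
    ∃ χ : Space → ℝ, IsWeakGradient χ a := by
  -- A genuinely measurable representative is chosen so that `b (x - s • t)` is jointly measurable
  -- in `(x, t, s)` for Fubini.
  let b : Space → Fin 3 → ℝ := fun x k => (ha k).aestronglyMeasurable.mk _ x
  have hab (k) : (fun x => a x k) =ᵐ[volume] fun x => b x k :=
    (ha k).aestronglyMeasurable.ae_eq_mk
  have hint (η : Space → ℝ) (k) : ∫ x, η x * a x k = ∫ x, η x * b x k :=
    integral_congr_ae ((hab k).mono fun x hx => congrArg (η x * ·) hx)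
  obtain ⟨χ, hχ⟩ := exists_isWeakGradient_of_stronglyMeasurable (a := b)
    (fun k => (ha k).congr (hab k)) (fun k => (ha k).aestronglyMeasurable.stronglyMeasurable_mk)
    (fun φ hφ i k => by rw [← hint, ← hint, hcurl φ hφ i k])
  exact ⟨χ, hχ.locallyIntegrable, ha, fun η hη k =>
    (hint η k).trans (hχ.integral_eq η hη k)⟩

lemma IsVectorPotential.gaugeEquivalentVector {A₁ A₂ B₁ B₂ : Space → Space}
    (hA₁ : IsVectorPotential A₁ B₁) (hA₂ : IsVectorPotential A₂ B₂)
    (hB : ∀ᵐ x, B₁ x = B₂ x) : GaugeEquivalentVector A₁ A₂ := by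
  have hl₁ (k) := locallyIntegrable_apply (locallyIntegrableOn_univ.1 hA₁.curl.locallyIntegrableOn) k
  have hl₂ (k) := locallyIntegrable_apply (locallyIntegrableOn_univ.1 hA₂.curl.locallyIntegrableOn) k
  refine exists_isWeakGradient_of_curl_eq_zero (fun k => (hl₂ k).sub (hl₁ k)) ?_
  intro φ hφ
  have hi₁ (i k) : Integrable fun x => pderiv i φ x * A₁ x k := (hφ.pderiv i).integrable_smul (hl₁ k)
  have hi₂ (i k) : Integrable fun x => pderiv i φ x * A₂ x k := (hφ.pderiv i).integrable_smul (hl₂ k)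
  have hcyc (k : Fin 3) : ∫ x, pderiv (k + 1) φ x * (A₂ x (k + 2) - A₁ x (k + 2))
      = ∫ x, pderiv (k + 2) φ x * (A₂ x (k + 1) - A₁ x (k + 1)) := by
    have h1 := hA₁.curl.integral_eq φ hφ k
    have h2 := hA₂.curl.integral_eq φ hφ k
    have h3 : ∫ x, φ x * B₁ x k = ∫ x, φ x * B₂ x k :=
      integral_congr_ae (hB.mono fun x hx => by simp only [hx])
    rw [integral_sub (hi₁ _ _) (hi₁ _ _)] at h1
    rw [integral_sub (hi₂ _ _) (hi₂ _ _)] at h2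
    simp only [mul_sub]
    rw [integral_sub (hi₂ _ _) (hi₁ _ _), integral_sub (hi₂ _ _) (hi₁ _ _)]
    linarith
  have h0 := hcyc 0
  have h1 := hcyc 1
  have h2 := hcyc 2
  intro i k
  fin_cases i <;> fin_cases k
  -- The diagonal cases are trivial; the six others are the three cyclic curl components and their
  -- mirror images.
  all_goals first
    | rfl
    | exact h0
    | exact h1
    | exact h2
    | exact h0.symm
    | exact h1.symm
    | exact h2.symm

lemma IsWeakCurlOn.congr_ae {U : Set Space} {G G' B : Space → Space} (h : IsWeakCurlOn U G B)
    (hG : ∀ᵐ x, G x = G' x) : IsWeakCurlOn U G' B where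
  locallyIntegrableOn := fun x hx => by
    obtain ⟨s, hs, hi⟩ := h.locallyIntegrableOn x hx
    exact ⟨s, hs, hi.congr (ae_restrict_of_ae hG)⟩
  locallyIntegrableOn_curl := h.locallyIntegrableOn_curl
  integral_eq := fun φ hφ k => (h.integral_eq φ hφ k).trans <| congrArg Neg.neg <|
    integral_congr_ae (hG.mono fun x hx => by simp only [hx])

end OneElectron
end

/-! ### Assembly of the theorem -/

theorem mainTheorem7
    (A₁ A₂ B₁ B₂ : OneElectron.Space → OneElectron.Space)
    (hA₁ : OneElectron.IsVectorPotential A₁ B₁)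
    (hA₂ : OneElectron.IsVectorPotential A₂ B₂)
    (s₁ : OneElectron.State A₁) (s₂ : OneElectron.State A₂)
    (ρ : OneElectron.Space → ℝ) (j : OneElectron.Space → OneElectron.Space)
    (hρ : ∀ᵐ x, ρ x ≠ 0)
    (hρ₁ : ∀ᵐ x, s₁.density x = ρ x) (hρ₂ : ∀ᵐ x, s₂.density x = ρ x)
    (hj₁ : ∀ᵐ x, s₁.totalCurrent x = j x) (hj₂ : ∀ᵐ x, s₂.totalCurrent x = j x) :
    (∀ U : Set OneElectron.Space, IsOpen U →
      (∀ K : Set OneElectron.Space, IsCompact K → K ⊆ U →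
        ∃ c : ℝ, 0 < c ∧ ∀ᵐ x, x ∈ K → c ≤ ρ x) →
      OneElectron.IsWeakCurlOn U (fun x => (ρ x)⁻¹ • j x) B₁) ∧
    (∀ᵐ x, B₁ x = B₂ x) ∧
    OneElectron.GaugeEquivalentVector A₁ A₂ ∧
    (∀ (v₁ v₂ : OneElectron.Space → ℝ) (E₁ E₂ : ℝ),
      s₁.IsEigenstate v₁ E₁ → s₂.IsEigenstate v₂ E₂ →
      OneElectron.GaugeEquivalent v₁ A₁ v₂ A₂) := by
  have h0 : ∀ᵐ x, s₁.density x ≠ 0 := by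
    filter_upwards [hρ, hρ₁] with x h1 h2 using h2 ▸ h1
  have hρ' : ∀ᵐ x, s₁.density x = s₂.density x := by
    filter_upwards [hρ₁, hρ₂] with x h1 h2 using h1.trans h2.symm
  have hj' : ∀ᵐ x, s₁.totalCurrent x = s₂.totalCurrent x := by
    filter_upwards [hj₁, hj₂] with x h1 h2 using h1.trans h2.symm
  have hB := OneElectron.State.curl_ae_eq hA₁ hA₂ s₁ s₂ h0 hρ' hj'
  have hg := hA₁.gaugeEquivalentVector hA₂ hB
  refine ⟨fun U hU hK => ?_, hB, hg, fun v₁ v₂ E₁ E₂ h₁ h₂ => ⟨hg, ?_⟩⟩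
  · refine (s₁.isWeakCurlOn_velocity hA₁ h0 hU fun K hKc hKU => ?_).congr_ae ?_
    · obtain ⟨c, hc, h⟩ := hK K hKc hKU
      refine ⟨c, hc, ?_⟩
      filter_upwards [h, hρ₁] with x hx h1 hxK using h1 ▸ hx hxK
    · filter_upwards [hρ₁, hj₁] with x h1 h2 using by rw [h1, h2]
  · exact h₁.exists_const h₂ hA₁.locMemLp hA₂.locMemLp h0 hρ' hj'
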